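/- **Setting.** Let $\phi$ be a continuous bounded regressor on $[0,\infty)$ with values in $\mathbb R^n$, $\theta^\star\in\mathbb R^n$ an unknown parameter, $d$ a Lebesgue measurable disturbance, and $\psi(\theta^\star,t)=\phi(t)^\top\theta^\star+d(t)$ the measured signal ($\phi$ and $d$ are also defined at the recording times below). Datasets $(\Phi_q,\Psi_q)$ are indexed by $q\in\mathcal Q=\{1,\dots,\bar q\}$, $\bar q\ge1$, and $\mathcal Q=\mathcal Q_s\cup\mathcal Q_i\cup\mathcal Q_c$ with $\mathcal Q_s\cap(\mathcal Q_i\cup\mathcal Q_c)=\emptyset$. For $q\in\mathcal Q_s\cup\mathcal Q_i$, with recording times $t_{q,k}$, $$\Phi_q=\sum_{k=1}^{\bar k_q}\phi(t_{q,k})\phi(t_{q,k})^\top,\qquad \Psi_q=\sum_{k=1}^{\bar k_q}\phi(t_{q,k})\psi(\theta^\star,t_{q,k}).$$ For $q\in\mathcal Q_s$ the dataset is sufficiently rich: $\Phi_q\succeq\alpha_qI$ with $\alpha_q>0$. For $q\in\mathcal Q_i$ one has $\Phi_q\succeq aI$ with $a=0$ but with no $a>0$. For $q\in\mathcal Q_c$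 the matrix $\Phi_q$ is corrupted: indefinite, negative definite or not symmetric (and $\Psi_q\in\mathbb R^n$ is arbitrary). Fix $k_t,k_r,\Upsilon,T_0>0$ and $N_0\ge1$. For $\ell\in[1,\infty]$ let $F_{\mu,1}(\mu)=\mu/\Upsilon$, $F_{\mu,\ell}(\mu)=\frac{\ell}{\ell-1}\mu^{2-1/\ell}/\Upsilon$ for $1<\ell<\infty$, and $F_{\mu,\infty}(\mu)=\mu^2/\Upsilon$. The solution of $\dot\mu=F_{\mu,\ell}(\mu)$ with $\mu(0)=c\ge1$ exists on $[0,T_{c,\ell})$, where $T_{c,1}=\infty$, $T_{c,\ell}=\Upsilon c^{(1-\ell)/\ell}$ for $1<\ell<\infty$, and $T_{c,\infty}=\Upsilon/c$. Let $\mathcal D_{c,\ell}$ be its primitive vanishing at $0$: $$\mathcal D_{c,1}(t)=\Upsilon(ce^{t/\Upsilon}-c),\qquad \mathcal D_{c,\infty}(t)=\Upsilon\ln\frac{\Upsilon}{\Upsilon-ct},$$ $$\mathcal D_{c,\ell}(t)=(\ell-1)\Upsilon\Big(\Upsilon^{\frac1{\ell-1}}\big(\Upsilon c^{\frac{1-\ell}\ell}-t\big)^{\frac1{1-\ell}}-c^{\frac1\ell}\Big)\quad(1<\ell<\infty).$$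 The closed loop is the hybrid system with state $z=(\theta,q,\rho_d,\rho_a,\tau,\mu)$ that may flow when $q\in\mathcal Q$, $\rho_d\in[0,N_0]$, $\rho_a\in[0,T_0]$, $\tau\ge0$, $\mu\ge1$, according to $$\dot\theta=-\mu\big(k_t\phi(\tau)(\phi(\tau)^\top\theta-\psi(\theta^\star,\tau))+k_r(\Phi_q\theta-\Psi_q)\big),\quad \dot q=0,\quad \dot\rho_d\in\mu\big[0,\tfrac1{\tau_d}\big],$$ $$\dot\rho_a\in\mu\big(\big[0,\tfrac1{\tau_a}\big]-\mathbb I_{\mathcal Q_i\cup\mathcal Q_c}(q)\big),\quad\dot\tau=1,\quad\dot\mu=F_{\mu,\ell}(\mu),$$ and may jump when in addition $\rho_d\in[1,N_0]$, by $q^+\in\mathcal Q\setminus\{q\}$, $\rho_d^+=\rho_d-1$, all other components being unchanged. Solutions are hybrid arcs on hybrid time domains, locally absolutely continuous during flows. **Theorem.** Suppose that (a) $\mathcal Q_s\neq\emptyset$, and (b) $\tau_d>0$ and $\tau_a>1+\dfrac{\varpi}{k_r\underline\alpha}$, where $\underline\alpha=\min_{q\in\mathcal Q_s}\alpha_q$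 and $\varpi=1+k_r\max_{q\in\mathcal Q_c}\|\Phi_q\|$ (spectral norm; the maximum over the empty set is $0$). Then there exist $\kappa_1,\kappa_2>0$ and class-$\mathcal K$ functions $\gamma_1,\gamma_2,\gamma_3$ (continuous, strictly increasing, zero at zero), independent of $\theta^\star$, $d$, of $\Psi_q$ for $q\in\mathcal Q_c$, of $\ell$ and of the solution, such that for every $\ell\in[1,\infty]$ and every solution $z$, with $\mu_0=\mu(0,0)$, $\tau_0=\tau(0,0)$ and $\vartheta_0=\theta(0,0)-\theta^\star$, every $(t,j)\in\operatorname{dom}z$ satisfies $t<T_{\mu_0,\ell}$ and, provided the supremum below is finite, $$|\theta(t,j)-\theta^\star|\le\kappa_1e^{-\kappa_2\mathcal D_{\mu_0,\ell}(t)}e^{-\kappa_2j}|\vartheta_0|+\Gamma(t),$$ $$\Gamma(t)=\gamma_1\Big(\sup_{0\le s\le t}|d(\tau_0+s)|\Big)+\gamma_2(|d_r|)+\gamma_3\Big(\max_{q\in\mathcal Q_c}|\Phi_q\theta^\star-\Psi_q|\Big),$$ where $d_r=(d(t_{q,k}))_{q\in\mathcal Q_s\cup\mathcal Q_i,\,1\le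 k\le\bar k_q}$ is the vector of the recorded-data noise (and the maximum over the empty set is $0$). Consequently, still whenever the supremum in $\Gamma(t)$ is finite: 1. (Hyperexponential convergence, $\ell=1$.) For every $r>0$ there is $M>0$, independent of $\theta^\star,d,\Psi_q$ $(q\in\mathcal Q_c)$ and of the solution, with $|\theta(t,j)-\theta^\star|\le Me^{-rt}e^{-\kappa_2j}|\vartheta_0|+\Gamma(t)$ on $\operatorname{dom}z$. 2. (Prescribed-time ultimate boundedness, $\ell>1$.) For all $\mu_0\ge1$ and $R,\varepsilon>0$ there is $t_\varepsilon\in[0,T_{\mu_0,\ell})$, independent of $\theta^\star,d,\Psi_q$ $(q\in\mathcal Q_c)$ and of the solution, such that every solution with $\mu(0,0)=\mu_0$ and $|\vartheta_0|\le R$ satisfies $|\theta(t,j)-\theta^\star|\le\varepsilon+\Gamma(t)$ for all $(t,j)\in\operatorname{dom}z$ with $t\ge t_\varepsilon$. -/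

import Mathlib

open scoped NNReal ENNReal
open MeasureTheory

noncomputable section

namespace CL

/-! ### Hybrid dynamical systems -/

/-- Data `(C, F, D, G)` of a hybrid inclusion
`z ∈ C, ż ∈ F z` (flows), `z ∈ D, z⁺ ∈ G z` (jumps). -/
structure HybridSystem (E : Type*) where
  flowSet : Set E
  flowMap : E → Set E
  jumpSet : Set E
  jumpMap : E → Set E

/-- `S = ⋃_{j < J} [t_j, t_{j+1}] × {j}` for some `0 = t_0 ≤ t_1 ≤ … ≤ t_J`. -/
def IsCompactHybridTimeDomain (S : Set (ℝ × ℕ)) : Prop :=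
  ∃ (J : ℕ) (t : ℕ → ℝ), t 0 = 0 ∧ (∀ j < J, t j ≤ t (j + 1)) ∧
    S = {p : ℝ × ℕ | p.2 < J ∧ t p.2 ≤ p.1 ∧ p.1 ≤ t (p.2 + 1)}

/-- Every truncation `S ∩ ([0, T] × {0, …, J})` with `(T, J) ∈ S` is compact. -/
def IsHybridTimeDomain (S : Set (ℝ × ℕ)) : Prop :=
  (∀ p ∈ S, 0 ≤ p.1) ∧
  ∀ p ∈ S, IsCompactHybridTimeDomain (S ∩ {r : ℝ × ℕ | 0 ≤ r.1 ∧ r.1 ≤ p.1 ∧ r.2 ≤ p.2})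

/-- `I_j = {t : (t, j) ∈ S}`. -/
def slice (S : Set (ℝ × ℕ)) (j : ℕ) : Set ℝ := {t : ℝ | (t, j) ∈ S}

/-- Solutions of a hybrid system (not necessarily maximal). The values of `z` outside `dom` are
irrelevant. -/
structure HybridSystem.IsSolution {E : Type*} [NormedAddCommGroup E] [NormedSpace ℝ E]
    (H : HybridSystem E) (dom : Set (ℝ × ℕ)) (z : ℝ → ℕ → E) : Prop where
  time_domain : IsHybridTimeDomain dom
  start_mem : ((0 : ℝ), (0 : ℕ)) ∈ dom
  init : z 0 0 ∈ closure H.flowSet ∪ H.jumpSet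
  locally_ac : ∀ (j : ℕ) (a b : ℝ), a ≤ b → (a, j) ∈ dom → (b, j) ∈ dom →
    AbsolutelyContinuousOnInterval (fun t => z t j) a b
  flow_mem : ∀ j : ℕ, ∀ t ∈ interior (slice dom j), z t j ∈ H.flowSet
  flow : ∀ j : ℕ, ∀ᵐ t ∂(volume : Measure ℝ), t ∈ interior (slice dom j) →
    ∃ f ∈ H.flowMap (z t j), HasDerivAt (fun s => z s j) f t
  jump : ∀ (t : ℝ) (j : ℕ), (t, j) ∈ dom → (t, j + 1) ∈ dom →
    z t j ∈ H.jumpSet ∧ z t (j + 1) ∈ H.jumpMap (z t j)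

/-! ### Dynamic gains, indexed by `ℓ ∈ [1, ∞]` -/

/-- The gain flow map `F_{μ,ℓ}`. -/
def gainFlow (Υ : ℝ) (ℓ : ℝ≥0∞) (μ : ℝ) : ℝ :=
  if ℓ = 1 then μ / Υ
  else if ℓ = ⊤ then μ ^ 2 / Υ
  else ℓ.toReal / (ℓ.toReal - 1) * (μ ^ (2 - 1 / ℓ.toReal) / Υ)

/-- The (prescribed) end time `T_{c,ℓ}` of the gain started at `c`; infinite for `ℓ = 1`. -/
def endTime (Υ : ℝ) (ℓ : ℝ≥0∞) (c : ℝ) : EReal :=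
  if ℓ = 1 then ⊤
  else if ℓ = ⊤ then ((Υ / c : ℝ) : EReal)
  else ((Υ * c ^ ((1 - ℓ.toReal) / ℓ.toReal) : ℝ) : EReal)

/-- The time dilation `𝒟_{c,ℓ}` on `[0, T_{c,ℓ})`: the primitive, vanishing at `0`, of the gain
started at `c`. -/
def dilation (Υ : ℝ) (ℓ : ℝ≥0∞) (c t : ℝ) : ℝ :=
  if ℓ = 1 then Υ * (c * Real.exp (t / Υ) - c)
  else if ℓ = ⊤ then Υ * Real.log (Υ / (Υ - c * t))
  else (ℓ.toReal - 1) * Υ *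
    (Υ ^ (1 / (ℓ.toReal - 1)) *
        (Υ * c ^ ((1 - ℓ.toReal) / ℓ.toReal) - t) ^ (1 / (1 - ℓ.toReal))
      - c ^ (1 / ℓ.toReal))

/-! ### Datasets -/

/-- A matrix acting on Euclidean space; its norm is the spectral norm of the matrix. -/
abbrev act {n : ℕ} (M : Matrix (Fin n) (Fin n) ℝ) :
    EuclideanSpace ℝ (Fin n) →L[ℝ] EuclideanSpace ℝ (Fin n) :=
  Matrix.toEuclideanCLM (𝕜 := ℝ) M

/-- `M ⪰ a I`, as symmetric matrices. -/
def RichWithLevel {n : ℕ} (M : Matrix (Fin n) (Fin n) ℝ) (a : ℝ) : Prop :=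
  (M - a • (1 : Matrix (Fin n) (Fin n) ℝ)).PosSemidef

def SufficientlyRich {n : ℕ} (M : Matrix (Fin n) (Fin n) ℝ) : Prop :=
  ∃ a : ℝ, 0 < a ∧ RichWithLevel M a

/-- `M ⪰ a I` holds with `a = 0`, but with no `a > 0`. -/
def InsufficientlyRich {n : ℕ} (M : Matrix (Fin n) (Fin n) ℝ) : Prop :=
  RichWithLevel M 0 ∧ ¬ SufficientlyRich M

/-- Indefinite, negative definite, or not symmetric. -/
def Corrupted {n : ℕ} (M : Matrix (Fin n) (Fin n) ℝ) : Prop :=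
  ((∃ v, 0 < dotProduct v (M.mulVec v)) ∧ ∃ w, dotProduct w (M.mulVec w) < 0) ∨
    (-M).PosDef ∨ ¬ M.IsSymm

/-! ### The concurrent-learning algorithm -/

/-- What is known to, or tuned by, the user, and the regressor data of the datasets. -/
structure Algorithm (n : ℕ) where
  /-- regressor; only `[0, ∞)` and the recording times matter -/
  φ : ℝ → EuclideanSpace ℝ (Fin n)
  /-- number of datasets; these are indexed by `1, …, qbar` -/
  qbar : ℕ
  Qs : Finset ℕ
  Qi : Finset ℕ
  Qc : Finset ℕ
  /-- number of records in a dataset -/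
  kbar : ℕ → ℕ
  /-- recording times -/
  tr : (q : ℕ) → Fin (kbar q) → ℝ
  /-- regressor data matrices in use -/
  Φ : ℕ → Matrix (Fin n) (Fin n) ℝ
  kt : ℝ
  kr : ℝ
  Υ : ℝ
  τd : ℝ
  τa : ℝ
  N0 : ℝ
  T0 : ℝ

/-- `Σ_k φ_{q,k} φ_{q,k}ᵀ`. -/
def Algorithm.recordedMatrix {n : ℕ} (A : Algorithm n) (q : ℕ) : Matrix (Fin n) (Fin n) ℝ :=
  ∑ k : Fin (A.kbar q), Matrix.vecMulVec (A.φ (A.tr q k)) (A.φ (A.tr q k))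

/-- Standing assumptions on the algorithm. -/
structure Algorithm.Standing {n : ℕ} (A : Algorithm n) : Prop where
  regressor_continuous : ContinuousOn A.φ (Set.Ici 0)
  regressor_bounded : ∃ b : ℝ, ∀ t : ℝ, 0 ≤ t → ‖A.φ t‖ ≤ b
  one_le_qbar : 1 ≤ A.qbar
  union : A.Qs ∪ A.Qi ∪ A.Qc = Finset.Icc 1 A.qbar
  disjoint : Disjoint A.Qs (A.Qi ∪ A.Qc)
  recorded : ∀ q ∈ A.Qs ∪ A.Qi, A.Φ q = A.recordedMatrix q
  rich : ∀ q ∈ A.Qs, SufficientlyRich (A.Φ q)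
  poor : ∀ q ∈ A.Qi, InsufficientlyRich (A.Φ q)
  corrupted : ∀ q ∈ A.Qc, Corrupted (A.Φ q)
  kt_pos : 0 < A.kt
  kr_pos : 0 < A.kr
  Υ_pos : 0 < A.Υ
  T0_pos : 0 < A.T0
  one_le_N0 : 1 ≤ A.N0

/-- `ϖ = 1 + k_r max_{q ∈ Q_c} ‖Φ_q‖` (the maximum over the empty set being `0`). -/
def Algorithm.varpi {n : ℕ} (A : Algorithm n) : ℝ :=
  1 + A.kr * ((A.Qc.sup fun q => ‖act (A.Φ q)‖₊ : ℝ≥0) : ℝ)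

/-- The unknown parameter, the unknown disturbance, and the signal data vectors in use. -/
structure Unknowns (n : ℕ) where
  θstar : EuclideanSpace ℝ (Fin n)
  d : ℝ → ℝ
  Ψ : ℕ → EuclideanSpace ℝ (Fin n)

/-- The measured signal `ψ(θ⋆, t) = φ(t)ᵀ θ⋆ + d(t)`. -/
def Unknowns.signal {n : ℕ} (U : Unknowns n) (A : Algorithm n) (t : ℝ) : ℝ :=
  inner ℝ (A.φ t) U.θstar + U.d t

/-- The disturbance is Lebesgue measurable, and the uncorrupted datasets use
`Ψ_q = Σ_k φ_{q,k} ψ(θ⋆, t_{q,k})`. The signal vector of a corrupted dataset is arbitrary. -/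
structure Unknowns.Compatible {n : ℕ} (U : Unknowns n) (A : Algorithm n) : Prop where
  measurable : AEMeasurable U.d (volume.restrict (Set.Ici 0))
  recorded : ∀ q ∈ A.Qs ∪ A.Qi,
    U.Ψ q = ∑ k : Fin (A.kbar q), U.signal A (A.tr q k) • A.φ (A.tr q k)

/-- `χ(θ, t) = φ(t) (φ(t)ᵀ θ - ψ(θ⋆, t))`. -/
def chi {n : ℕ} (A : Algorithm n) (U : Unknowns n) (θ : EuclideanSpace ℝ (Fin n)) (t : ℝ) :
    EuclideanSpace ℝ (Fin n) :=
  (inner ℝ (A.φ t) θ - U.signal A t) • A.φ t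

/-- `Ω_q(θ, τ) = -k_t χ(θ, τ) - k_r (Φ_q θ - Ψ_q)`. -/
def learningMap {n : ℕ} (A : Algorithm n) (U : Unknowns n) (q : ℕ)
    (θ : EuclideanSpace ℝ (Fin n)) (τ : ℝ) : EuclideanSpace ℝ (Fin n) :=
  -(A.kt • chi A U θ τ) - A.kr • (act (A.Φ q) θ - U.Ψ q)

/-! ### The data-querying automaton, with state `y = (q, ρ_d, ρ_a)` -/

/-- The index set `{1, …, qbar}` (or a subset of it) as a set of reals. -/
def realModes (S : Finset ℕ) : Set ℝ := {x : ℝ | ∃ i ∈ S, x = (i : ℝ)}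

def Cσ {n : ℕ} (A : Algorithm n) : Set (ℝ × ℝ × ℝ) :=
  realModes (Finset.Icc 1 A.qbar) ×ˢ (Set.Icc 0 A.N0 ×ˢ Set.Icc 0 A.T0)

def Dσ {n : ℕ} (A : Algorithm n) : Set (ℝ × ℝ × ℝ) :=
  realModes (Finset.Icc 1 A.qbar) ×ˢ (Set.Icc 1 A.N0 ×ˢ Set.Icc 0 A.T0)

def badIndicator {n : ℕ} (A : Algorithm n) (q : ℝ) : ℝ :=
  (realModes (A.Qi ∪ A.Qc)).indicator (fun _ => (1 : ℝ)) q

def Fσ {n : ℕ} (A : Algorithm n) (y : ℝ × ℝ × ℝ) : Set (ℝ × ℝ × ℝ) :=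
  {0} ×ˢ (Set.Icc 0 (1 / A.τd) ×ˢ
    Set.Icc (0 - badIndicator A y.1) (1 / A.τa - badIndicator A y.1))

def Gσ {n : ℕ} (A : Algorithm n) (y : ℝ × ℝ × ℝ) : Set (ℝ × ℝ × ℝ) :=
  (realModes (Finset.Icc 1 A.qbar) \ {y.1}) ×ˢ ({y.2.1 - 1} ×ˢ {y.2.2})

/-! ### The closed loop, with state `z = (θ, y, τ, μ)` -/

abbrev State (n : ℕ) : Type := EuclideanSpace ℝ (Fin n) × (ℝ × ℝ × ℝ) × ℝ × ℝ

abbrev State.θ {n : ℕ} (z : State n) : EuclideanSpace ℝ (Fin n) := z.1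
abbrev State.y {n : ℕ} (z : State n) : ℝ × ℝ × ℝ := z.2.1
abbrev State.τ {n : ℕ} (z : State n) : ℝ := z.2.2.1
abbrev State.μ {n : ℕ} (z : State n) : ℝ := z.2.2.2

def closedLoop {n : ℕ} (A : Algorithm n) (U : Unknowns n) (ℓ : ℝ≥0∞) :
    HybridSystem (State n) where
  flowSet := {z | State.y z ∈ Cσ A ∧ 0 ≤ State.τ z ∧ 1 ≤ State.μ z}
  flowMap z := {f | ∃ q : ℕ, (State.y z).1 = (q : ℝ) ∧
    f.1 = State.μ z • learningMap A U q (State.θ z) (State.τ z) ∧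
    (∃ g ∈ Fσ A (State.y z), f.2.1 = State.μ z • g) ∧
    f.2.2.1 = 1 ∧
    f.2.2.2 = gainFlow A.Υ ℓ (State.μ z)}
  jumpSet := {z | State.y z ∈ Dσ A ∧ 0 ≤ State.τ z ∧ 1 ≤ State.μ z}
  jumpMap z := {w | State.θ w = State.θ z ∧ State.y w ∈ Gσ A (State.y z) ∧
    State.τ w = State.τ z ∧ State.μ w = State.μ z}

/-! ### The quantities in the error bound -/

/-- Class `𝒦`: continuous, strictly increasing and zero at zero (hence positive definite). -/
def ClassK (γ : ℝ≥0 → ℝ≥0) : Prop := Continuous γ ∧ StrictMono γ ∧ γ 0 = 0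

/-- The disturbance is bounded along `[τ0, τ0 + t]`. -/
def Unknowns.BoundedOn {n : ℕ} (U : Unknowns n) (τ0 t : ℝ) : Prop :=
  BddAbove (Set.range fun s : Set.Icc (0 : ℝ) t => ‖U.d (τ0 + s)‖₊)

/-- `sup_{0 ≤ s ≤ t} |d(τ0 + s)|`. -/
def Unknowns.supDisturbance {n : ℕ} (U : Unknowns n) (τ0 t : ℝ) : ℝ≥0 :=
  ⨆ s : Set.Icc (0 : ℝ) t, ‖U.d (τ0 + s)‖₊

/-- `d_r`: the noise `d(t_{q,k})` in all records of the datasets in `Q_s ∪ Q_i`. -/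
def Unknowns.recordedNoise {n : ℕ} (U : Unknowns n) (A : Algorithm n) :
    EuclideanSpace ℝ (Σ q : {q : ℕ // q ∈ A.Qs ∪ A.Qi}, Fin (A.kbar q)) :=
  WithLp.toLp 2 fun p => U.d (A.tr p.1 p.2)

/-- `sup_{q ∈ Q_c} |Φ_q θ⋆ - Ψ_q|` (zero if `Q_c` is empty). -/
def Unknowns.corruptionLevel {n : ℕ} (U : Unknowns n) (A : Algorithm n) : ℝ≥0 :=
  A.Qc.sup fun q => ‖act (A.Φ q) U.θstar - U.Ψ q‖₊

/-- `γ₁(sup |d|) + γ₂(|d_r|) + γ₃(sup_{q ∈ Q_c} |Φ_q θ⋆ - Ψ_q|)`. -/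
def gains {n : ℕ} (A : Algorithm n) (U : Unknowns n) (γ₁ γ₂ γ₃ : ℝ≥0 → ℝ≥0) (τ0 t : ℝ) : ℝ :=
  (γ₁ (U.supDisturbance τ0 t) : ℝ) + (γ₂ ‖U.recordedNoise A‖₊ : ℝ) +
    (γ₃ (U.corruptionLevel A) : ℝ)

end CL

end

/-! Weigh the squared error by the timers: V = exp(2(c ρ_a + κ ρ_d)) |θ - θ⋆|². Measured in dilated
time, which runs at speed μ, a rich mode contracts the error at rate at least k_r α and any other
mode expands it at rate at most ϖ - 1 (`Algorithm.Standing.neg_inner_act_le`). With c = k_r α + (ϖ -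
1), the gap between these rates, the forced drain of ρ_a in bad modes pays for the missing
contraction. Every mode then keeps the net rate lam = k_r α - c/τ_a, which the condition on τ_a
makes positive. A jump spends one unit of ρ_d and so multiplies V by exp(-2κ); κ is small enough
that refilling ρ_d costs only part of lam. Disturbance, recorded noise and corruption enter linearly
in the error, and Young's inequality gives dV/dt ≤ μ(-2κ V + const)
(`exists_hasDerivAt_lyapunov_le`). The timers are bounded, so V is comparable to the squared error.

The gain equation is never solved. A primitive of 1/F advances at unit speed along solutions and a
primitive of μ/F at speed μ. The first determines μ from t and forces t to stay below the end time;
the increment of the second is the dilation (`lt_endTime_and_dilation_eq`). It also supplies the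
integrating factor in `lyapunov_le`, and a square root yields `norm_error_le`. The two consequences
only concern the growth of the dilation: superlinear for ℓ = 1, blow-up at a finite time for ℓ > 1.

Flows obey the inclusion only almost everywhere, so monotonicity comes from absolute continuity
(`HybridSystem.IsSolution.sub_le_of_flow`), and flows and jumps are spliced by
`IsHybridTimeDomain.induction`. -/

/-! ### Absolutely continuous curves. -/

open Set Filter Topology in
/-- A Lipschitz function of an absolutely continuous curve is absolutely continuous. -/
theorem LipschitzOnWith.comp_absolutelyContinuousOnInterval {E F : Type*} [PseudoMetricSpace E]
    [PseudoMetricSpace F] {γ : ℝ → E} {g : E → F} {a b : ℝ} {K : ℝ≥0}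
    (hg : LipschitzOnWith K g (γ '' uIcc a b)) (hγ : AbsolutelyContinuousOnInterval γ a b) :
    AbsolutelyContinuousOnInterval (fun t => g (γ t)) a b := by
  rw [absolutelyContinuousOnInterval_iff] at hγ ⊢
  intro ε hε
  -- Dividing by K + 1 instead of K covers K = 0.
  obtain ⟨δ, hδ, h⟩ := hγ (ε / (K + 1)) (by positivity)
  refine ⟨δ, hδ, fun I hI hsum => ?_⟩
  have h1 := h I hI hsum
  have hK : (0 : ℝ) < K + 1 := by positivity
  calc ∑ i ∈ Finset.range I.1, dist (g (γ (I.2 i).1)) (g (γ (I.2 i).2))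
      ≤ ∑ i ∈ Finset.range I.1, (K + 1) * dist (γ (I.2 i).1) (γ (I.2 i).2) := by
        refine Finset.sum_le_sum fun i hi => ?_
        refine (hg.dist_le_mul _ (mem_image_of_mem _ (hI.1 i hi).1) _
          (mem_image_of_mem _ (hI.1 i hi).2)).trans ?_
        gcongr
        linarith
    _ = (K + 1) * ∑ i ∈ Finset.range I.1, dist (γ (I.2 i).1) (γ (I.2 i).2) := by
        rw [Finset.mul_sum]
    _ < ε := by
        rw [lt_div_iff₀ hK] at h1
        linarith

open Set in
/-- A `C¹` function of an absolutely continuous curve is absolutely continuous. -/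
theorem AbsolutelyContinuousOnInterval.comp_contDiffAt {E F : Type*} [NormedAddCommGroup E]
    [NormedSpace ℝ E] [NormedAddCommGroup F] [NormedSpace ℝ F] {γ : ℝ → E} {g : E → F} {a b : ℝ}
    (hγ : AbsolutelyContinuousOnInterval γ a b)
    (hg : ∀ t ∈ uIcc a b, ContDiffAt ℝ 1 g (γ t)) :
    AbsolutelyContinuousOnInterval (fun t => g (γ t)) a b := by
  have hc : IsCompact (γ '' uIcc a b) := isCompact_uIcc.image_of_continuousOn hγ.continuousOn
  have hl : LocallyLipschitzOn (γ '' uIcc a b) g := by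
    rintro _ ⟨t, ht, rfl⟩
    obtain ⟨K, s, hs, hK⟩ := (hg t ht).exists_lipschitzOnWith
    exact ⟨K, s, mem_nhdsWithin_of_mem_nhds hs, hK⟩
  obtain ⟨K, hK⟩ := hl.exists_lipschitzOnWith_of_compact hc
  exact hK.comp_absolutelyContinuousOnInterval hγ

/-- Mean value inequality for absolutely continuous functions. -/
theorem AbsolutelyContinuousOnInterval.sub_le_of_ae_hasDerivAt_le {f : ℝ → ℝ} {a b c : ℝ}
    (hf : AbsolutelyContinuousOnInterval f a b) (hab : a ≤ b)
    (h : ∀ᵐ t, t ∈ Set.Ioo a b → ∃ f', HasDerivAt f f' t ∧ f' ≤ c) :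
    f b - f a ≤ c * (b - a) := by
  rw [← hf.integral_deriv_eq_sub]
  calc ∫ t in a..b, deriv f t ≤ ∫ _ in a..b, c := by
        refine intervalIntegral.integral_mono_ae_restrict hab hf.intervalIntegrable_deriv
          intervalIntegrable_const ?_
        rw [Measure.restrict_congr_set Ioo_ae_eq_Icc.symm]
        refine (ae_restrict_iff' measurableSet_Ioo).2 ?_
        filter_upwards [h] with t ht hmem
        obtain ⟨f', hf', hle⟩ := ht hmem
        rw [hf'.deriv]
        exact hle
    _ = c * (b - a) := by simp [mul_comm]

/-! ### Induction and invariance along hybrid solutions. -/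

namespace CL

/-- Every point is reached from the origin by alternating full flow intervals and jumps, followed by
one partial flow. -/
theorem IsCompactHybridTimeDomain.induction {S : Set (ℝ × ℕ)} (hS : IsCompactHybridTimeDomain S)
    {P : ℝ → ℕ → Prop} (h0 : P 0 0)
    (hflow : ∀ (a b : ℝ) (j : ℕ), 0 ≤ a → a ≤ b → (∀ t ∈ Set.Icc a b, (t, j) ∈ S) → P a j → P b j)
    (hjump : ∀ (t : ℝ) (j : ℕ), 0 ≤ t → (t, j) ∈ S → (t, j + 1) ∈ S → P t j → P t (j + 1))
    {t : ℝ} {j : ℕ} (h : (t, j) ∈ S) : P t j := by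
  obtain ⟨J, τ, hτ0, hτ, rfl⟩ := hS
  -- It is enough to reach the left end of each flow interval.
  have key : ∀ i < J, 0 ≤ τ i ∧ P (τ i) i := by
    intro i
    induction i with
    | zero => intro _; rw [hτ0]; exact ⟨le_rfl, h0⟩
    | succ i ih =>
      intro hi
      have hi' : i < J := by omega
      obtain ⟨hn, hP⟩ := ih hi'
      have hle := hτ i hi'
      refine ⟨hn.trans hle, hjump _ _ (hn.trans hle) ⟨hi', hle, le_rfl⟩
        ⟨hi, le_rfl, hτ _ hi⟩ ?_⟩
      exact hflow _ _ _ hn hle (fun s hs => ⟨hi', hs.1, hs.2⟩) hP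
  obtain ⟨hj, h1, h2⟩ := h
  obtain ⟨hn, hP⟩ := key j hj
  exact hflow _ _ _ hn h1 (fun s hs => ⟨hj, hs.1, hs.2.trans h2⟩) hP

theorem IsHybridTimeDomain.induction {S : Set (ℝ × ℕ)} (hS : IsHybridTimeDomain S)
    {P : ℝ → ℕ → Prop} (h0 : P 0 0)
    (hflow : ∀ (a b : ℝ) (j : ℕ), 0 ≤ a → a ≤ b → (∀ t ∈ Set.Icc a b, (t, j) ∈ S) → P a j → P b j)
    (hjump : ∀ (t : ℝ) (j : ℕ), 0 ≤ t → (t, j) ∈ S → (t, j + 1) ∈ S → P t j → P t (j + 1))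
    {t : ℝ} {j : ℕ} (h : (t, j) ∈ S) : P t j :=
  (hS.2 _ h).induction h0 (fun a b i h0 hab hI => hflow a b i h0 hab fun s hs => (hI s hs).1)
    (fun s i h0 h1 h2 => hjump s i h0 h1.1 h2.1) ⟨h, hS.1 _ h, le_rfl, le_rfl⟩

section
variable {E : Type*} [NormedAddCommGroup E] [NormedSpace ℝ E] {H : HybridSystem E}
  {dom : Set (ℝ × ℕ)} {z : ℝ → ℕ → E}

theorem mem_interior_slice {a b t : ℝ} {j : ℕ} (hI : ∀ t ∈ Set.Icc a b, (t, j) ∈ dom)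
    (ht : t ∈ Set.Ioo a b) : t ∈ interior (slice dom j) :=
  interior_maximal (fun s hs => hI s (Set.Ioo_subset_Icc_self hs)) isOpen_Ioo ht

/-- Growth of a `C¹` function of the state along a flow. -/
theorem HybridSystem.IsSolution.sub_le_of_flow (hz : H.IsSolution dom z) {a b c : ℝ} {j : ℕ}
    (hab : a ≤ b) (hI : ∀ t ∈ Set.Icc a b, (t, j) ∈ dom) (G : E → ℝ)
    (hG : ∀ t ∈ Set.Icc a b, ContDiffAt ℝ 1 G (z t j))
    (h : ∀ t ∈ Set.Ioo a b, ∀ f ∈ H.flowMap (z t j), HasDerivAt (fun s => z s j) f t →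
      ∃ g', HasDerivAt (fun s => G (z s j)) g' t ∧ g' ≤ c) :
    G (z b j) - G (z a j) ≤ c * (b - a) := by
  have hac := hz.locally_ac j a b hab (hI a ⟨le_rfl, hab⟩) (hI b ⟨hab, le_rfl⟩)
  refine (hac.comp_contDiffAt (g := G) (by rwa [Set.uIcc_of_le hab])).sub_le_of_ae_hasDerivAt_le
    hab ?_
  filter_upwards [hz.flow j] with t ht hmem
  obtain ⟨f, hf, hd⟩ := ht (mem_interior_slice hI hmem)
  exact h t hmem f hf hd

/-- A flow starting in a closed flow set stays in it. -/
theorem HybridSystem.IsSolution.mem_flowSet_of_flow (hz : H.IsSolution dom z)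
    (hC : IsClosed H.flowSet) {a b : ℝ} {j : ℕ} (hab : a ≤ b)
    (hI : ∀ t ∈ Set.Icc a b, (t, j) ∈ dom) (ha : z a j ∈ H.flowSet) : z b j ∈ H.flowSet := by
  rcases hab.eq_or_lt with rfl | hlt
  · exact ha
  have hac := hz.locally_ac j a b hab (hI a ⟨le_rfl, hab⟩) (hI b ⟨hab, le_rfl⟩)
  have hcont : ContinuousWithinAt (fun t => z t j) (Set.Ioo a b) b :=
    (hac.continuousOn b (by simp)).mono
      (by rw [Set.uIcc_of_le hab]; exact Set.Ioo_subset_Icc_self)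
  -- Solutions are required to lie in the flow set only at interior times; the right endpoint
  -- follows by continuity and closedness.
  have hb : b ∈ closure (Set.Ioo a b) := by
    rw [closure_Ioo hlt.ne]; exact ⟨hab, le_rfl⟩
  refine hC.closure_subset (hcont.mem_closure hb fun t ht => ?_)
  exact hz.flow_mem j t (mem_interior_slice hI ht)

/-- If flow and jump sets lie in a closed flow set that jumps preserve, solutions never leave it. -/
theorem HybridSystem.IsSolution.mem_flowSet (hz : H.IsSolution dom z)
    (hC : IsClosed H.flowSet) (hD : H.jumpSet ⊆ H.flowSet)
    (hG : ∀ x ∈ H.jumpSet, H.jumpMap x ⊆ H.flowSet) {t : ℝ} {j : ℕ} (h : (t, j) ∈ dom) :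
    z t j ∈ H.flowSet := by
  refine hz.time_domain.induction (P := fun t j => z t j ∈ H.flowSet) ?_ ?_ ?_ h
  · rcases hz.init with h | h
    · exact hC.closure_subset h
    · exact hD h
  · exact fun a b j _ hab hI ha => hz.mem_flowSet_of_flow hC hab hI ha
  · intro t j _ h1 h2 _
    obtain ⟨hd, hg⟩ := hz.jump t j h1 h2
    exact hG _ hd hg

end

/-! ### The gain equation and its time dilation. -/

/-- A primitive of `μ / F_{μ,ℓ}(μ)`. -/
noncomputable def gainPotential (Υ : ℝ) (ℓ : ℝ≥0∞) (μ : ℝ) : ℝ :=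
  if ℓ = 1 then Υ * μ
  else if ℓ = ⊤ then Υ * Real.log μ
  else (ℓ.toReal - 1) * Υ * μ ^ (1 / ℓ.toReal)

/-- A primitive of `1 / F_{μ,ℓ}(μ)`. -/
noncomputable def gainClock (Υ : ℝ) (ℓ : ℝ≥0∞) (μ : ℝ) : ℝ :=
  if ℓ = 1 then Υ * Real.log μ
  else if ℓ = ⊤ then -(Υ * μ⁻¹)
  else -(Υ * μ ^ ((1 - ℓ.toReal) / ℓ.toReal))

theorem one_lt_toReal {ℓ : ℝ≥0∞} (h : 1 ≤ ℓ) (h1 : ℓ ≠ 1) (ht : ℓ ≠ ⊤) : 1 < ℓ.toReal := by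
  have := (ENNReal.toReal_lt_toReal ENNReal.one_ne_top ht).2 (lt_of_le_of_ne h h1.symm)
  simpa using this

theorem contDiffAt_gainPotential (Υ : ℝ) (ℓ : ℝ≥0∞) {μ : ℝ} (hμ : 0 < μ) :
    ContDiffAt ℝ 1 (gainPotential Υ ℓ) μ := by
  unfold gainPotential
  split_ifs
  · fun_prop
  · exact contDiffAt_const.mul (Real.contDiffAt_log.2 hμ.ne')
  · exact contDiffAt_const.mul (Real.contDiffAt_rpow_const_of_ne hμ.ne')

theorem contDiffAt_gainClock (Υ : ℝ) (ℓ : ℝ≥0∞) {μ : ℝ} (hμ : 0 < μ) :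
    ContDiffAt ℝ 1 (gainClock Υ ℓ) μ := by
  unfold gainClock
  split_ifs
  · exact contDiffAt_const.mul (Real.contDiffAt_log.2 hμ.ne')
  · exact (contDiffAt_const.mul (contDiffAt_inv ℝ hμ.ne')).neg
  · exact (contDiffAt_const.mul (Real.contDiffAt_rpow_const_of_ne hμ.ne')).neg

/-- The product with the gain flow is what the chain rule produces along solutions, so the three
formulas for the derivative need not be exposed. -/
theorem exists_hasDerivAt_gainPotential {Υ : ℝ} (hΥ : 0 < Υ) {ℓ : ℝ≥0∞} (hℓ : 1 ≤ ℓ) {μ : ℝ}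
    (hμ : 0 < μ) :
    ∃ p, HasDerivAt (gainPotential Υ ℓ) p μ ∧ p * gainFlow Υ ℓ μ = μ := by
  unfold gainPotential gainFlow
  split_ifs with h1 ht
  · exact ⟨Υ * 1, (hasDerivAt_id μ).const_mul Υ, by field_simp⟩
  · exact ⟨Υ * μ⁻¹, (Real.hasDerivAt_log hμ.ne').const_mul Υ, by field_simp⟩
  · have hl := one_lt_toReal hℓ h1 ht
    set l := ℓ.toReal
    refine ⟨_, (Real.hasDerivAt_rpow_const (Or.inl hμ.ne')).const_mul ((l - 1) * Υ), ?_⟩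
    have h2 : μ ^ (1 / l - 1) * μ ^ (2 - 1 / l) = μ := by
      rw [← Real.rpow_add hμ]; ring_nf; simp
    have h3 : l - 1 ≠ 0 := by linarith
    calc (l - 1) * Υ * (1 / l * μ ^ (1 / l - 1)) * (l / (l - 1) * (μ ^ (2 - 1 / l) / Υ))
        = μ ^ (1 / l - 1) * μ ^ (2 - 1 / l) := by field_simp
      _ = μ := h2

theorem exists_hasDerivAt_gainClock {Υ : ℝ} (hΥ : 0 < Υ) {ℓ : ℝ≥0∞} (hℓ : 1 ≤ ℓ) {μ : ℝ}
    (hμ : 0 < μ) :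
    ∃ p, HasDerivAt (gainClock Υ ℓ) p μ ∧ p * gainFlow Υ ℓ μ = 1 := by
  unfold gainClock gainFlow
  split_ifs with h1 ht
  · exact ⟨Υ * μ⁻¹, (Real.hasDerivAt_log hμ.ne').const_mul Υ, by field_simp⟩
  · exact ⟨-(Υ * -(μ ^ 2)⁻¹), ((hasDerivAt_inv hμ.ne').const_mul Υ).neg, by field_simp⟩
  · have hl := one_lt_toReal hℓ h1 ht
    set l := ℓ.toReal
    refine ⟨_, ((Real.hasDerivAt_rpow_const (Or.inl hμ.ne')).const_mul Υ).neg, ?_⟩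
    have h2 : μ ^ ((1 - l) / l - 1) * μ ^ (2 - 1 / l) = 1 := by
      rw [← Real.rpow_add hμ]
      have : (1 - l) / l - 1 + (2 - 1 / l) = 0 := by field_simp; ring
      rw [this, Real.rpow_zero]
    have h3 : l - 1 ≠ 0 := by linarith
    calc -(Υ * ((1 - l) / l * μ ^ ((1 - l) / l - 1))) * (l / (l - 1) * (μ ^ (2 - 1 / l) / Υ))
        = μ ^ ((1 - l) / l - 1) * μ ^ (2 - 1 / l) := by field_simp; ring
      _ = 1 := h2

/-- The clock of the gain determines the gain before the end time, where the dilation is the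
increment of the potential. -/
theorem lt_endTime_and_dilation_eq {Υ : ℝ} (hΥ : 0 < Υ) {ℓ : ℝ≥0∞} (hℓ : 1 ≤ ℓ) {c μ t : ℝ}
    (hc : 0 < c) (hμ : 0 < μ) (h : gainClock Υ ℓ μ = gainClock Υ ℓ c + t) :
    (t : EReal) < endTime Υ ℓ c ∧
      dilation Υ ℓ c t = gainPotential Υ ℓ μ - gainPotential Υ ℓ c := by
  unfold gainClock at h
  unfold endTime dilation gainPotential
  split_ifs at h ⊢ with h1 ht
  · refine ⟨EReal.coe_lt_top t, ?_⟩
    have : t / Υ = Real.log μ - Real.log c := by field_simp; linarith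
    rw [this, Real.exp_sub, Real.exp_log hμ, Real.exp_log hc]
    field_simp
  · have hΥc : Υ - c * t = Υ * c * μ⁻¹ := by
      have : t = Υ * c⁻¹ - Υ * μ⁻¹ := by linarith
      rw [this]; field_simp; ring
    constructor
    · rw [EReal.coe_lt_coe_iff, lt_div_iff₀ hc]
      have : 0 < Υ * c * μ⁻¹ := by positivity
      linarith
    · rw [hΥc, ← mul_sub, ← Real.log_div hμ.ne' hc.ne']
      congr 2
      field_simp
  · have hl := one_lt_toReal hℓ h1 ht
    set l := ℓ.toReal
    -- The left side is the end time minus t. It is positive because the right side is, and raising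
    -- it to the power 1/(1 - l) recovers μ ^ (1/l) up to a power of Υ.
    have hΥc : Υ * c ^ ((1 - l) / l) - t = Υ * μ ^ ((1 - l) / l) := by linarith
    constructor
    · rw [EReal.coe_lt_coe_iff]
      have : 0 < Υ * μ ^ ((1 - l) / l) := by positivity
      linarith
    · rw [hΥc, Real.mul_rpow hΥ.le (by positivity), ← Real.rpow_mul hμ.le, ← mul_assoc,
        ← Real.rpow_add hΥ]
      have h3 : l - 1 ≠ 0 := by linarith
      have h4 : 1 - l ≠ 0 := by linarith
      have e1 : 1 / (l - 1) + 1 / (1 - l) = 0 := by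
        rw [← neg_sub l 1, one_div_neg_eq_neg_one_div]; ring
      have e2 : (1 - l) / l * (1 / (1 - l)) = 1 / l := by field_simp
      rw [e1, e2, Real.rpow_zero]
      ring

/-- For `ℓ = 1` the dilated time outgrows every linear function of time. -/
theorem exists_mul_le_dilation_one {Υ : ℝ} (hΥ : 0 < Υ) {κ : ℝ} (hκ : 0 < κ) (r : ℝ) :
    ∃ C : ℝ, ∀ c t : ℝ, 1 ≤ c → 0 ≤ t → r * t - C ≤ κ * dilation Υ 1 c t := by
  -- From exp x - 1 ≥ x²/2 with x = t/Υ, the constant is Υ times the maximum of r x - κ x²/2. Since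
  -- c ≥ 1, it does not depend on c.
  refine ⟨Υ * r ^ 2 / (2 * κ), fun c t hc ht => ?_⟩
  have hx : 0 ≤ t / Υ := by positivity
  have htx : t = Υ * (t / Υ) := by field_simp
  have hq := Real.quadratic_le_exp_of_nonneg hx
  have h1 : (t / Υ) ^ 2 / 2 ≤ Real.exp (t / Υ) - 1 := by linarith
  have h2 : dilation Υ 1 c t = Υ * (c * (Real.exp (t / Υ) - 1)) := by
    simp only [dilation, if_true]; ring
  rw [h2]
  set x := t / Υ
  have h3 : x ^ 2 / 2 ≤ c * (Real.exp x - 1) := by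
    have : 0 ≤ (c - 1) * (Real.exp x - 1) :=
      mul_nonneg (by linarith) ((by positivity : (0 : ℝ) ≤ x ^ 2 / 2).trans h1)
    linarith
  have h4 : r * x - r ^ 2 / (2 * κ) ≤ κ * (x ^ 2 / 2) := by
    have : κ * (x ^ 2 / 2) - (r * x - r ^ 2 / (2 * κ)) = (κ * x - r) ^ 2 / (2 * κ) := by
      field_simp; ring
    have : 0 ≤ (κ * x - r) ^ 2 / (2 * κ) := by positivity
    linarith
  calc r * t - Υ * r ^ 2 / (2 * κ) = Υ * (r * x - r ^ 2 / (2 * κ)) := by rw [htx]; ring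
    _ ≤ Υ * (κ * (x ^ 2 / 2)) := by gcongr
    _ ≤ Υ * (κ * (c * (Real.exp x - 1))) := by gcongr
    _ = κ * (Υ * (c * (Real.exp x - 1))) := by ring

open Filter Topology in
/-- For `ℓ > 1` the dilated time blows up at a finite positive end time. -/
theorem exists_tendsto_dilation {Υ : ℝ} (hΥ : 0 < Υ) {ℓ : ℝ≥0∞} (hℓ : 1 < ℓ) {c : ℝ}
    (hc : 0 < c) :
    ∃ T : ℝ, 0 < T ∧ endTime Υ ℓ c = T ∧ Tendsto (dilation Υ ℓ c) (𝓝[<] T) atTop := by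
  unfold endTime
  have h1 : ℓ ≠ 1 := hℓ.ne'
  rw [if_neg h1]
  -- In both cases the dilation is singular through an affine function of t that decreases to zero
  -- at T.
  have aux : ∀ {T a b : ℝ}, 0 < a → b = a * T →
      Tendsto (fun t => b - a * t) (𝓝[<] T) (𝓝[>] 0) := by
    intro T a b ha hb
    refine tendsto_nhdsWithin_iff.2 ⟨?_, ?_⟩
    · have : Tendsto (fun t => b - a * t) (𝓝 T) (𝓝 (b - a * T)) :=
        (by fun_prop : Continuous fun t : ℝ => b - a * t).tendsto T
      rw [hb, sub_self] at this
      rw [hb]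
      exact this.mono_left nhdsWithin_le_nhds
    · filter_upwards [self_mem_nhdsWithin] with t ht
      have : a * t < a * T := mul_lt_mul_of_pos_left ht ha
      simp only [Set.mem_Ioi]
      linarith
  split_ifs with ht
  · refine ⟨Υ / c, by positivity, rfl, ?_⟩
    have hd : dilation Υ ℓ c = fun t => Υ * Real.log (Υ / (Υ - c * t)) := by
      funext t; simp [dilation, ht]
    rw [hd]
    refine Tendsto.const_mul_atTop hΥ (Real.tendsto_log_atTop.comp ?_)
    have := (aux (T := Υ / c) hc (b := Υ) (by field_simp)).inv_tendsto_nhdsGT_zero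
    exact Tendsto.const_mul_atTop hΥ this
  · have hl := one_lt_toReal hℓ.le h1 ht
    refine ⟨Υ * c ^ ((1 - ℓ.toReal) / ℓ.toReal), by positivity, rfl, ?_⟩
    have hd : dilation Υ ℓ c = fun t => (ℓ.toReal - 1) * Υ * (Υ ^ (1 / (ℓ.toReal - 1)) *
        (Υ * c ^ ((1 - ℓ.toReal) / ℓ.toReal) - t) ^ (1 / (1 - ℓ.toReal)) -
          c ^ (1 / ℓ.toReal)) := by
      funext t; simp [dilation, h1, ht]
    rw [hd]
    set l := ℓ.toReal
    have hl1 : 0 < l - 1 := by linarith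
    refine Tendsto.const_mul_atTop (by positivity) (tendsto_atTop_add_const_right _ _
      (Tendsto.const_mul_atTop (by positivity) ?_))
    have h0 := aux (T := Υ * c ^ ((1 - l) / l)) one_pos (one_mul _).symm
    simp only [one_mul] at h0
    have hneg : 1 / (1 - l) < 0 := one_div_neg.2 (by linarith)
    exact (tendsto_rpow_neg_nhdsGT_zero hneg).comp h0

end CL

/-! ### Datasets and the energy estimate in each mode. -/

namespace CL

variable {n : ℕ}

theorem RichWithLevel.mul_norm_sq_le {M : Matrix (Fin n) (Fin n) ℝ} {a : ℝ}
    (h : RichWithLevel M a) (x : EuclideanSpace ℝ (Fin n)) :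
    a * ‖x‖ ^ 2 ≤ inner ℝ x (act M x) := by
  have h1 := h.dotProduct_mulVec_nonneg x.ofLp
  rw [Matrix.sub_mulVec, dotProduct_sub, Matrix.smul_mulVec, Matrix.one_mulVec,
    dotProduct_smul] at h1
  rw [Matrix.inner_toEuclideanCLM, EuclideanSpace.real_norm_sq_eq]
  simp only [star_trivial, smul_eq_mul, dotProduct, ← sq] at h1 ⊢
  linarith

theorem act_recordedMatrix (A : Algorithm n) (q : ℕ) (x : EuclideanSpace ℝ (Fin n)) :
    act (A.recordedMatrix q) x =
      ∑ k : Fin (A.kbar q), inner ℝ (A.φ (A.tr q k)) x • A.φ (A.tr q k) := by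
  rw [act, Algorithm.recordedMatrix, map_sum, sum_apply]
  refine Finset.sum_congr rfl fun k _ => ?_
  ext i
  rw [Matrix.ofLp_toEuclideanCLM, Matrix.vecMulVec_mulVec]
  simp [PiLp.inner_apply, dotProduct, mul_comm]

/-- Total size of the recorded regressors. -/
noncomputable def Algorithm.recordedSize (A : Algorithm n) : ℝ :=
  ∑ q ∈ A.Qs ∪ A.Qi, ∑ k : Fin (A.kbar q), ‖A.φ (A.tr q k)‖

theorem Algorithm.recordedSize_nonneg (A : Algorithm n) : 0 ≤ A.recordedSize := by
  unfold recordedSize; positivity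

theorem Unknowns.abs_d_le_recordedNoise (U : Unknowns n) (A : Algorithm n) {q : ℕ}
    (hq : q ∈ A.Qs ∪ A.Qi) (k : Fin (A.kbar q)) : |U.d (A.tr q k)| ≤ ‖U.recordedNoise A‖ := by
  have := PiLp.norm_apply_le (U.recordedNoise A) ⟨⟨q, hq⟩, k⟩
  simpa [Unknowns.recordedNoise] using this

/-- The mismatch of every dataset at the true parameter. -/
theorem Unknowns.Compatible.norm_mismatch_le {A : Algorithm n} (hA : A.Standing) {U : Unknowns n}
    (hU : U.Compatible A) {q : ℕ} (hq : q ∈ Finset.Icc 1 A.qbar) :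
    ‖act (A.Φ q) U.θstar - U.Ψ q‖ ≤
      A.recordedSize * ‖U.recordedNoise A‖ + U.corruptionLevel A := by
  rw [← hA.union, Finset.mem_union] at hq
  rcases hq with hq | hq
  · have hsum : act (A.Φ q) U.θstar - U.Ψ q =
        -∑ k : Fin (A.kbar q), U.d (A.tr q k) • A.φ (A.tr q k) := by
      rw [hA.recorded q hq, act_recordedMatrix, hU.recorded q hq, ← Finset.sum_sub_distrib,
        ← Finset.sum_neg_distrib]
      refine Finset.sum_congr rfl fun k _ => ?_
      rw [Unknowns.signal, ← sub_smul, sub_add_cancel_left, neg_smul]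
    have h1 : ‖act (A.Φ q) U.θstar - U.Ψ q‖ ≤ A.recordedSize * ‖U.recordedNoise A‖ := by
      rw [hsum, norm_neg]
      calc ‖∑ k : Fin (A.kbar q), U.d (A.tr q k) • A.φ (A.tr q k)‖
          ≤ ∑ k : Fin (A.kbar q), ‖A.φ (A.tr q k)‖ * ‖U.recordedNoise A‖ := by
            refine norm_sum_le_of_le _ fun k _ => ?_
            rw [norm_smul, mul_comm, Real.norm_eq_abs]
            gcongr
            exact U.abs_d_le_recordedNoise A hq k
        _ = (∑ k : Fin (A.kbar q), ‖A.φ (A.tr q k)‖) * ‖U.recordedNoise A‖ := by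
            rw [Finset.sum_mul]
        -- Summing over all uncorrupted datasets makes the constant independent of the mode.
        _ ≤ A.recordedSize * ‖U.recordedNoise A‖ := by
            gcongr
            exact Finset.single_le_sum
              (f := fun q => ∑ k : Fin (A.kbar q), ‖A.φ (A.tr q k)‖)
              (fun _ _ => by positivity) hq
    exact h1.trans (le_add_of_nonneg_right (NNReal.coe_nonneg _))
  · have h1 : ‖act (A.Φ q) U.θstar - U.Ψ q‖₊ ≤ U.corruptionLevel A :=
      Finset.le_sup (f := fun q => ‖act (A.Φ q) U.θstar - U.Ψ q‖₊) hq
    have h2 : 0 ≤ A.recordedSize * ‖U.recordedNoise A‖ :=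
      mul_nonneg A.recordedSize_nonneg (norm_nonneg _)
    have h3 : ‖act (A.Φ q) U.θstar - U.Ψ q‖ ≤ (U.corruptionLevel A : ℝ) := h1
    linarith

theorem badIndicator_natCast (A : Algorithm n) (q : ℕ) :
    badIndicator A q = if q ∈ A.Qi ∪ A.Qc then 1 else 0 := by
  have : (q : ℝ) ∈ realModes (A.Qi ∪ A.Qc) ↔ q ∈ A.Qi ∪ A.Qc := by
    simp only [realModes, Set.mem_ofPred_eq, Nat.cast_inj]
    exact ⟨fun ⟨i, hi, h⟩ => h ▸ hi, fun h => ⟨q, h, rfl⟩⟩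
  rw [badIndicator]
  split_ifs with h
  · exact Set.indicator_of_mem (this.2 h) _
  · exact Set.indicator_of_notMem (mt this.1 h) _

/-- The dataset term decreases the error in rich modes and increases it by a bounded rate in the
others. -/
theorem Algorithm.Standing.neg_inner_act_le {A : Algorithm n} (hA : A.Standing) {a : ℝ}
    (hrich : ∀ q ∈ A.Qs, RichWithLevel (A.Φ q) a) {q : ℕ}
    (hq : q ∈ Finset.Icc 1 A.qbar) (x : EuclideanSpace ℝ (Fin n)) :
    -(A.kr * inner ℝ x (act (A.Φ q) x)) ≤
      (-(A.kr * a) + (A.kr * a + (A.varpi - 1)) * badIndicator A q) * ‖x‖ ^ 2 := by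
  have hkr := hA.kr_pos
  rw [badIndicator_natCast]
  have hvar : 0 ≤ A.varpi - 1 := by
    rw [Algorithm.varpi, add_sub_cancel_left]; positivity
  rw [← hA.union, Finset.union_assoc, Finset.mem_union] at hq
  -- In a bad mode the coefficient collapses to ϖ - 1, in a rich one to -k_r a. Writing both as one
  -- affine function of the indicator lets the drain of ρ_a cancel it later.
  split_ifs with hb
  · have hle : -(A.kr * inner ℝ x (act (A.Φ q) x)) ≤ (A.varpi - 1) * ‖x‖ ^ 2 := by
      rcases Finset.mem_union.1 hb with hi | hc
      · have := (hA.poor q hi).1.mul_norm_sq_le x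
        rw [zero_mul] at this
        have h1 : 0 ≤ A.kr * inner ℝ x (act (A.Φ q) x) := mul_nonneg hkr.le this
        have h2 : 0 ≤ (A.varpi - 1) * ‖x‖ ^ 2 := by positivity
        linarith
      · have h1 : ‖act (A.Φ q)‖ ≤ ((A.Qc.sup fun q => ‖act (A.Φ q)‖₊ : ℝ≥0) : ℝ) :=
          NNReal.coe_le_coe.2 (Finset.le_sup (f := fun q => ‖act (A.Φ q)‖₊) hc)
        have h2 : -(inner ℝ x (act (A.Φ q) x)) ≤ ‖x‖ * (‖act (A.Φ q)‖ * ‖x‖) := by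
          refine (neg_le_abs _).trans ((abs_real_inner_le_norm _ _).trans ?_)
          gcongr
          exact (act (A.Φ q)).le_opNorm x
        rw [Algorithm.varpi, add_sub_cancel_left]
        calc -(A.kr * inner ℝ x (act (A.Φ q) x)) = A.kr * -(inner ℝ x (act (A.Φ q) x)) := by ring
          _ ≤ A.kr * (‖x‖ * (((A.Qc.sup fun q => ‖act (A.Φ q)‖₊ : ℝ≥0) : ℝ) * ‖x‖)) := by
            gcongr
            exact h2.trans (by gcongr)
          _ = _ := by ring
    linarith
  · have hs : q ∈ A.Qs := hq.resolve_right hb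
    have := mul_le_mul_of_nonneg_left ((hrich q hs).mul_norm_sq_le x) hkr.le
    linarith

/-- Energy estimate for the learning dynamics. -/
theorem Unknowns.Compatible.inner_learningMap_le {A : Algorithm n} (hA : A.Standing)
    {U : Unknowns n} (hU : U.Compatible A) {a : ℝ}
    (hrich : ∀ q ∈ A.Qs, RichWithLevel (A.Φ q) a) {q : ℕ}
    (hq : q ∈ Finset.Icc 1 A.qbar) {b : ℝ} (hb : ∀ t : ℝ, 0 ≤ t → ‖A.φ t‖ ≤ b)
    (θ : EuclideanSpace ℝ (Fin n)) {τ δ : ℝ} (hτ : 0 ≤ τ) (hδ : |U.d τ| ≤ δ) :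
    inner ℝ (θ - U.θstar) (learningMap A U q θ τ) ≤
      (-(A.kr * a) + (A.kr * a + (A.varpi - 1)) * badIndicator A q) * ‖θ - U.θstar‖ ^ 2 +
      (A.kt * b * δ + A.kr * (A.recordedSize * ‖U.recordedNoise A‖ + U.corruptionLevel A)) *
        ‖θ - U.θstar‖ := by
  have hkr := hA.kr_pos
  have hkt := hA.kt_pos
  obtain ⟨x, rfl⟩ : ∃ x, θ = x + U.θstar := ⟨θ - U.θstar, by simp⟩
  rw [add_sub_cancel_right]
  have hmain := hA.neg_inner_act_le hrich hq x
  have hmis := hU.norm_mismatch_le hA hq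
  set e := act (A.Φ q) U.θstar - U.Ψ q with he
  set E := A.recordedSize * ‖U.recordedNoise A‖ + U.corruptionLevel A
  set p : ℝ := inner ℝ x (A.φ τ) with hp
  have hexp : inner ℝ x (learningMap A U q (x + U.θstar) τ) =
      -(A.kt * p ^ 2) + A.kt * (U.d τ * p) - A.kr * inner ℝ x (act (A.Φ q) x)
        - A.kr * inner ℝ x e := by
    have h1 : act (A.Φ q) (x + U.θstar) - U.Ψ q = act (A.Φ q) x + e := by
      rw [he, map_add, add_sub_assoc]
    have h2 : inner ℝ (A.φ τ) (x + U.θstar) - U.signal A τ = p - U.d τ := by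
      rw [Unknowns.signal, inner_add_right, hp, real_inner_comm]; ring
    rw [learningMap, chi, h1, h2]
    simp only [inner_sub_right, inner_neg_right, inner_smul_right, inner_add_right, ← hp]
    ring
  have hdp : U.d τ * p ≤ b * δ * ‖x‖ := by
    calc U.d τ * p ≤ |U.d τ| * |p| := by rw [← abs_mul]; exact le_abs_self _
      _ ≤ δ * (‖x‖ * b) := by
        have h0 : 0 ≤ δ := (abs_nonneg _).trans hδ
        gcongr
        exact (abs_real_inner_le_norm _ _).trans (by gcongr; exact hb τ hτ)
      _ = b * δ * ‖x‖ := by ring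
  have hxe : -(inner ℝ x e) ≤ E * ‖x‖ := by
    refine (neg_le_abs _).trans ((abs_real_inner_le_norm _ _).trans ?_)
    rw [mul_comm]
    gcongr
  have h1 := mul_le_mul_of_nonneg_left hdp hkt.le
  have h2 := mul_le_mul_of_nonneg_left hxe hkr.le
  -- The real-time term only helps through its square, which is discarded: no excitation of the
  -- regressor is needed.
  have h3 : 0 ≤ A.kt * p ^ 2 := by positivity
  rw [hexp]
  linarith

end CL

/-! ### Invariants of the closed loop. -/

namespace CL

variable {n : ℕ} {A : Algorithm n} {U : Unknowns n} {ℓ : ℝ≥0∞} {dom : Set (ℝ × ℕ)}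
  {z : ℝ → ℕ → State n}

theorem isClosed_realModes (S : Finset ℕ) : IsClosed (realModes S) := by
  have : realModes S = (fun i : ℕ => (i : ℝ)) '' (S : Set ℕ) := by
    ext x
    exact ⟨fun ⟨i, hi, h⟩ => ⟨i, hi, h.symm⟩, fun ⟨i, hi, h⟩ => ⟨i, hi, h.symm⟩⟩
  rw [this]
  exact (S.finite_toSet.image _).isClosed

theorem isClosed_closedLoop_flowSet (A : Algorithm n) (U : Unknowns n) (ℓ : ℝ≥0∞) :
    IsClosed (closedLoop A U ℓ).flowSet := by
  have hC : IsClosed (Cσ A) := (isClosed_realModes _).prod (isClosed_Icc.prod isClosed_Icc)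
  have h1 : Continuous fun x : State n => State.y x := by fun_prop
  have h2 : Continuous fun x : State n => State.τ x := by fun_prop
  have h3 : Continuous fun x : State n => State.μ x := by fun_prop
  exact (hC.preimage h1).inter
    ((isClosed_le continuous_const h2).inter (isClosed_le continuous_const h3))

/-- A jump requires ρ_d ≥ 1, so ρ_d - 1 is still admissible. The timer bounds and μ ≥ 1 thus hold on
the whole domain. -/
theorem closedLoop_mem_flowSet (hz : (closedLoop A U ℓ).IsSolution dom z) {t : ℝ} {j : ℕ}
    (h : (t, j) ∈ dom) : z t j ∈ (closedLoop A U ℓ).flowSet := by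
  refine hz.mem_flowSet (isClosed_closedLoop_flowSet A U ℓ) ?_ ?_ h
  · rintro x ⟨⟨hq, hd, ha⟩, hτ, hμ⟩
    exact ⟨⟨hq, ⟨zero_le_one.trans hd.1, hd.2⟩, ha⟩, hτ, hμ⟩
  · rintro x ⟨⟨hq, hd, ha⟩, hτ, hμ⟩ w ⟨-, ⟨hwq, hwd, hwa⟩, hwτ, hwμ⟩
    rw [Set.mem_singleton_iff] at hwd hwa
    refine ⟨⟨hwq.1, ?_, ?_⟩, ?_, ?_⟩
    · rw [hwd]; exact ⟨by linarith [hd.1], by linarith [hd.2]⟩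
    · rw [hwa]; exact ha
    · rw [hwτ]; exact hτ
    · rw [hwμ]; exact hμ

theorem one_le_μ (hz : (closedLoop A U ℓ).IsSolution dom z) {t : ℝ} {j : ℕ}
    (h : (t, j) ∈ dom) : 1 ≤ State.μ (z t j) := (closedLoop_mem_flowSet hz h).2.2

/-- A function of the state that flows with constant slope and ignores jumps is affine in time. -/
theorem HybridSystem.IsSolution.eq_add_mul {E : Type*} [NormedAddCommGroup E] [NormedSpace ℝ E]
    {H : HybridSystem E} {z : ℝ → ℕ → E} (hz : H.IsSolution dom z) (G : E → ℝ) (c : ℝ)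
    (hG : ∀ t j, (t, j) ∈ dom → ContDiffAt ℝ 1 G (z t j))
    (hflow : ∀ t j, (t, j) ∈ dom → ∀ f ∈ H.flowMap (z t j),
      HasDerivAt (fun s => z s j) f t → HasDerivAt (fun s => G (z s j)) c t)
    (hjump : ∀ t j, (t, j) ∈ dom → ∀ w ∈ H.jumpMap (z t j), G w = G (z t j))
    {t : ℝ} {j : ℕ} (h : (t, j) ∈ dom) : G (z t j) = G (z 0 0) + c * t := by
  refine hz.time_domain.induction (P := fun t j => G (z t j) = G (z 0 0) + c * t) (by simp)
    ?_ ?_ h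
  · intro a b j _ hab hI ha
    have h1 := hz.sub_le_of_flow (c := c) hab hI G (fun t ht => hG t j (hI t ht))
      (fun t ht f hf hd => ⟨c, hflow t j (hI t (Set.Ioo_subset_Icc_self ht)) f hf hd, le_rfl⟩)
    -- The growth bound is one-sided; applying it to -G as well gives equality.
    have h2 := hz.sub_le_of_flow (c := -c) hab hI (fun x => -G x)
      (fun t ht => (hG t j (hI t ht)).neg)
      (fun t ht f hf hd =>
        ⟨-c, (hflow t j (hI t (Set.Ioo_subset_Icc_self ht)) f hf hd).neg, le_rfl⟩)
    linarith
  · intro t j _ h1 h2 ih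
    rw [hjump t j h1 _ (hz.jump t j h1 h2).2, ih]

theorem hasDerivAt_fst_comp {E F : Type*} [NormedAddCommGroup E] [NormedSpace ℝ E]
    [NormedAddCommGroup F] [NormedSpace ℝ F] {y : ℝ → E × F} {f : E × F} {t : ℝ}
    (h : HasDerivAt y f t) : HasDerivAt (fun s => (y s).1) f.1 t :=
  (ContinuousLinearMap.fst ℝ E F).hasFDerivAt.comp_hasDerivAt t h

theorem hasDerivAt_snd_comp {E F : Type*} [NormedAddCommGroup E] [NormedSpace ℝ E]
    [NormedAddCommGroup F] [NormedSpace ℝ F] {y : ℝ → E × F} {f : E × F} {t : ℝ}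
    (h : HasDerivAt y f t) : HasDerivAt (fun s => (y s).2) f.2 t :=
  (ContinuousLinearMap.snd ℝ E F).hasFDerivAt.comp_hasDerivAt t h

section
variable {y : ℝ → State n} {f : State n} {t : ℝ}

theorem State.hasDerivAt_θ (h : HasDerivAt y f t) :
    HasDerivAt (fun s => State.θ (y s)) f.1 t :=
  hasDerivAt_fst_comp h

theorem State.hasDerivAt_y (h : HasDerivAt y f t) :
    HasDerivAt (fun s => State.y (y s)) f.2.1 t :=
  hasDerivAt_fst_comp (hasDerivAt_snd_comp h)

theorem State.hasDerivAt_ρd (h : HasDerivAt y f t) :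
    HasDerivAt (fun s => (State.y (y s)).2.1) f.2.1.2.1 t :=
  hasDerivAt_fst_comp (hasDerivAt_snd_comp (State.hasDerivAt_y h))

theorem State.hasDerivAt_ρa (h : HasDerivAt y f t) :
    HasDerivAt (fun s => (State.y (y s)).2.2) f.2.1.2.2 t :=
  hasDerivAt_snd_comp (hasDerivAt_snd_comp (State.hasDerivAt_y h))

theorem State.hasDerivAt_τ (h : HasDerivAt y f t) :
    HasDerivAt (fun s => State.τ (y s)) f.2.2.1 t :=
  hasDerivAt_fst_comp (hasDerivAt_snd_comp (hasDerivAt_snd_comp h))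

theorem State.hasDerivAt_μ (h : HasDerivAt y f t) :
    HasDerivAt (fun s => State.μ (y s)) f.2.2.2 t :=
  hasDerivAt_snd_comp (hasDerivAt_snd_comp (hasDerivAt_snd_comp h))

end

theorem τ_eq (hz : (closedLoop A U ℓ).IsSolution dom z) {t : ℝ} {j : ℕ} (h : (t, j) ∈ dom) :
    State.τ (z t j) = State.τ (z 0 0) + t := by
  have := hz.eq_add_mul (fun x => State.τ x) 1 (fun _ _ _ => by fun_prop)
    (fun t j _ f ⟨q, _, _, _, hτ, _⟩ hd => hτ ▸ State.hasDerivAt_τ hd)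
    (fun t j _ w hw => hw.2.2.1) h
  simpa using this

/-- The derivative of the clock is (1/F) · F = 1 and jumps leave μ alone. This replaces a uniqueness
theorem for the gain equation. -/
theorem gainClock_eq (hΥ : 0 < A.Υ) (hℓ : 1 ≤ ℓ) (hz : (closedLoop A U ℓ).IsSolution dom z)
    {t : ℝ} {j : ℕ} (h : (t, j) ∈ dom) :
    gainClock A.Υ ℓ (State.μ (z t j)) = gainClock A.Υ ℓ (State.μ (z 0 0)) + t := by
  have hpos : ∀ {t j}, (t, j) ∈ dom → 0 < State.μ (z t j) := fun h =>
    zero_lt_one.trans_le (one_le_μ hz h)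
  have := hz.eq_add_mul (fun x => gainClock A.Υ ℓ (State.μ x)) 1
    (fun t j h => (contDiffAt_gainClock A.Υ ℓ (hpos h)).comp (z t j)
      (by fun_prop : ContDiffAt ℝ 1 (fun x : State n => State.μ x) (z t j)))
    (fun t j h f ⟨q, _, _, _, _, hμ⟩ hd => by
      obtain ⟨p, hp, hp1⟩ := exists_hasDerivAt_gainClock hΥ hℓ (hpos h)
      rw [← hp1, ← hμ]
      exact hp.comp t (State.hasDerivAt_μ hd))
    (fun t j _ w hw => by rw [hw.2.2.2]) h
  simpa using this

theorem lt_endTime_and_dilation_eq_of_solution (hΥ : 0 < A.Υ) (hℓ : 1 ≤ ℓ)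
    (hz : (closedLoop A U ℓ).IsSolution dom z) {t : ℝ} {j : ℕ} (h : (t, j) ∈ dom) :
    (t : EReal) < endTime A.Υ ℓ (State.μ (z 0 0)) ∧
      dilation A.Υ ℓ (State.μ (z 0 0)) t =
        gainPotential A.Υ ℓ (State.μ (z t j)) - gainPotential A.Υ ℓ (State.μ (z 0 0)) :=
  lt_endTime_and_dilation_eq hΥ hℓ (zero_lt_one.trans_le (one_le_μ hz hz.start_mem))
    (zero_lt_one.trans_le (one_le_μ hz h)) (gainClock_eq hΥ hℓ hz h)

/-! ### The Lyapunov function and its decay. -/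

/-- Squared estimation error, weighted by the timers of the automaton. -/
noncomputable def lyapunov (θs : EuclideanSpace ℝ (Fin n)) (c κ : ℝ) (x : State n) : ℝ :=
  Real.exp (2 * (c * (State.y x).2.2 + κ * (State.y x).2.1)) * ‖State.θ x - θs‖ ^ 2

theorem contDiff_lyapunov (θs : EuclideanSpace ℝ (Fin n)) (c κ : ℝ) :
    ContDiff ℝ 1 (lyapunov θs c κ) := by
  have h1 : ContDiff ℝ 1 fun x : State n => ‖State.θ x - θs‖ ^ 2 :=
    ContDiff.norm_sq ℝ (by fun_prop)
  unfold lyapunov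
  fun_prop

/-- Decay of the weighted squared error along flows, where `lam` is the net convergence rate in
dilated time that the activation timer guarantees. -/
theorem exists_hasDerivAt_lyapunov_le (hA : A.Standing) (hU : U.Compatible A) {a : ℝ}
    (ha : 0 < a) (hrich : ∀ q ∈ A.Qs, RichWithLevel (A.Φ q) a)
    {b : ℝ} (hb : ∀ t : ℝ, 0 ≤ t → ‖A.φ t‖ ≤ b)
    {c κ lam : ℝ} (hc : c = A.kr * a + (A.varpi - 1))
    (hlam : lam = A.kr * a - c * (1 / A.τa)) (hlam0 : 0 < lam)
    (hκ0 : 0 < κ) (hκ : κ ≤ lam / 4) (hκd : κ * (1 / A.τd) ≤ lam / 4)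
    {δ D : ℝ}
    (hD : D = A.kt * b * δ + A.kr * (A.recordedSize * ‖U.recordedNoise A‖ + U.corruptionLevel A))
    {y : ℝ → State n} {t : ℝ} (hy : y t ∈ (closedLoop A U ℓ).flowSet)
    {f : State n} (hf : f ∈ (closedLoop A U ℓ).flowMap (y t)) (hd : HasDerivAt y f t)
    (hδ : |U.d (State.τ (y t))| ≤ δ) :
    ∃ v, HasDerivAt (fun s => lyapunov U.θstar c κ (y s)) v t ∧
      v ≤ State.μ (y t) * (-(2 * κ) * lyapunov U.θstar c κ (y t) +
        Real.exp (2 * (c * A.T0 + κ * A.N0)) * (D ^ 2 / lam)) := by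
  obtain ⟨⟨hqm, hρd, hρa⟩, hτ, hμ⟩ := hy
  obtain ⟨q, hq, hfθ, ⟨g, ⟨-, hgd, hga⟩, hg⟩, -, -⟩ := hf
  have hqI : q ∈ Finset.Icc 1 A.qbar := by
    obtain ⟨i, hi, h⟩ := hqm
    rw [hq, Nat.cast_inj] at h
    rwa [h]
  have hvar : 0 ≤ A.varpi - 1 := by
    have := hA.kr_pos
    rw [Algorithm.varpi, add_sub_cancel_left]; positivity
  have hc0 : 0 ≤ c := by
    have := mul_pos hA.kr_pos ha
    linarith
  have hin := hU.inner_learningMap_le hA hrich hqI hb (State.θ (y t)) hτ hδ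
  rw [← hc, ← hD] at hin
  have hexp := (((State.hasDerivAt_ρa hd).const_mul c).add
    ((State.hasDerivAt_ρd hd).const_mul κ)).const_mul 2 |>.exp
  have hsq := ((State.hasDerivAt_θ hd).sub_const U.θstar).norm_sq
  refine ⟨_, hexp.mul hsq, ?_⟩
  have hga2 : g.2.2 ≤ 1 / A.τa - badIndicator A q := by rw [← hq]; exact hga.2
  have hgd2 : g.2.1 ≤ 1 / A.τd := hgd.2
  have e1 : f.2.1.2.2 = State.μ (y t) * g.2.2 := by rw [hg]; rfl
  have e2 : f.2.1.2.1 = State.μ (y t) * g.2.1 := by rw [hg]; rfl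
  rw [e1, e2, hfθ, inner_smul_right]
  simp only [lyapunov, Pi.add_apply]
  set μ := State.μ (y t)
  set x := State.θ (y t) - U.θstar
  set I : ℝ := inner ℝ x (learningMap A U q (State.θ (y t)) (State.τ (y t)))
  set bad := badIndicator A q
  set w := Real.exp (2 * (c * (State.y (y t)).2.2 + κ * (State.y (y t)).2.1)) with hw
  have hw0 : 0 < w := Real.exp_pos _
  have hwE : w ≤ Real.exp (2 * (c * A.T0 + κ * A.N0)) := by
    rw [hw]
    have := hρa.2
    have := hρd.2
    gcongr
  -- The indicators cancel, leaving -2 lam. Refilling ρ_d costs at most lam/2, Young's inequality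
  -- for the input costs lam, and the remaining lam/2 is at least 2κ.
  have hrate : 2 * (c * g.2.2 + κ * g.2.1) * ‖x‖ ^ 2 + 2 * I ≤
      -(2 * κ) * ‖x‖ ^ 2 + D ^ 2 / lam := by
    have h1 : c * g.2.2 ≤ c * (1 / A.τa - bad) := mul_le_mul_of_nonneg_left hga2 hc0
    have h2 : κ * g.2.1 ≤ κ * (1 / A.τd) := mul_le_mul_of_nonneg_left hgd2 hκ0.le
    have h3 : (c * g.2.2 + κ * g.2.1) * ‖x‖ ^ 2 ≤
        (c * (1 / A.τa - bad) + lam / 4) * ‖x‖ ^ 2 := by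
      gcongr
      linarith
    have h4 : 2 * (D * ‖x‖) ≤ lam * ‖x‖ ^ 2 + D ^ 2 / lam := by
      have : lam * ‖x‖ ^ 2 + D ^ 2 / lam - 2 * (D * ‖x‖) = (lam * ‖x‖ - D) ^ 2 / lam := by
        field_simp; ring
      have : 0 ≤ (lam * ‖x‖ - D) ^ 2 / lam := by positivity
      linarith
    have h5 : κ * ‖x‖ ^ 2 ≤ lam / 4 * ‖x‖ ^ 2 := by gcongr
    have h6 : (c * (1 / A.τa - bad) + lam / 4) * ‖x‖ ^ 2 +
        (-(A.kr * a) + c * bad) * ‖x‖ ^ 2 = -(3 * lam / 4) * ‖x‖ ^ 2 := by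
      rw [hlam]; ring
    linarith
  calc w * (2 * (c * (μ * g.2.2) + κ * (μ * g.2.1))) * ‖x‖ ^ 2 + w * (2 * (μ * I))
      = μ * (w * (2 * (c * g.2.2 + κ * g.2.1) * ‖x‖ ^ 2 + 2 * I)) := by ring
    _ ≤ μ * (w * (-(2 * κ) * ‖x‖ ^ 2 + D ^ 2 / lam)) := by
        have : (0 : ℝ) ≤ μ := zero_le_one.trans hμ
        gcongr
    _ = μ * (-(2 * κ) * (w * ‖x‖ ^ 2) + w * (D ^ 2 / lam)) := by ring
    _ ≤ _ := by
        have : (0 : ℝ) ≤ μ := zero_le_one.trans hμ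
        gcongr

/-- Only ρ_d changes among the quantities in the weight and the error, and it drops by one. -/
theorem lyapunov_jump {c κ : ℝ} {θs : EuclideanSpace ℝ (Fin n)} {x w : State n}
    (hw : w ∈ (closedLoop A U ℓ).jumpMap x) :
    lyapunov θs c κ w = Real.exp (-(2 * κ)) * lyapunov θs c κ x := by
  obtain ⟨hθ, ⟨-, hd, ha⟩, -, -⟩ := hw
  rw [Set.mem_singleton_iff] at hd ha
  unfold lyapunov
  rw [hθ, hd, ha, ← mul_assoc, ← Real.exp_add]
  ring_nf

/-- Bound on the weighted squared error along a solution. -/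
theorem lyapunov_le (hA : A.Standing) (hU : U.Compatible A) (hℓ : 1 ≤ ℓ) {a : ℝ}
    (ha : 0 < a) (hrich : ∀ q ∈ A.Qs, RichWithLevel (A.Φ q) a)
    {b : ℝ} (hb : ∀ t : ℝ, 0 ≤ t → ‖A.φ t‖ ≤ b)
    {c κ lam : ℝ} (hc : c = A.kr * a + (A.varpi - 1))
    (hlam : lam = A.kr * a - c * (1 / A.τa)) (hlam0 : 0 < lam)
    (hκ0 : 0 < κ) (hκ : κ ≤ lam / 4) (hκd : κ * (1 / A.τd) ≤ lam / 4)
    {δ D : ℝ}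
    (hD : D = A.kt * b * δ + A.kr * (A.recordedSize * ‖U.recordedNoise A‖ + U.corruptionLevel A))
    (hz : (closedLoop A U ℓ).IsSolution dom z) {t : ℝ} {j : ℕ} (h : (t, j) ∈ dom)
    (hδ : ∀ s ∈ Set.Icc 0 t, |U.d (State.τ (z 0 0) + s)| ≤ δ) :
    lyapunov U.θstar c κ (z t j) ≤
      Real.exp (-(2 * κ) * dilation A.Υ ℓ (State.μ (z 0 0)) t) * Real.exp (-(2 * κ) * j) *
        lyapunov U.θstar c κ (z 0 0) +
      Real.exp (2 * (c * A.T0 + κ * A.N0)) * (D ^ 2 / lam) / (2 * κ) := by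
  -- B is the equilibrium of the comparison equation: the decay estimate reads dV/dt ≤ -2κ μ (V -
  -- B).
  set B := Real.exp (2 * (c * A.T0 + κ * A.N0)) * (D ^ 2 / lam) / (2 * κ) with hB
  have hB0 : 0 ≤ B := by positivity
  have hBeq : Real.exp (2 * (c * A.T0 + κ * A.N0)) * (D ^ 2 / lam) = 2 * κ * B := by
    rw [hB]; field_simp
  set V := lyapunov U.θstar c κ with hV
  set P : State n → ℝ := fun x => gainPotential A.Υ ℓ (State.μ x) with hP
  rw [(lt_endTime_and_dilation_eq_of_solution hA.Υ_pos hℓ hz h).2]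
  change V (z t j) ≤ Real.exp (-(2 * κ) * (P (z t j) - P (z 0 0))) * Real.exp (-(2 * κ) * j) *
        V (z 0 0) + B
  -- The guard s ≤ t is needed because the disturbance is bounded only up to time t.
  refine hz.time_domain.induction (P := fun s i => s ≤ t → V (z s i) ≤
    Real.exp (-(2 * κ) * (P (z s i) - P (z 0 0))) * Real.exp (-(2 * κ) * i) *
        V (z 0 0) + B) ?_ ?_ ?_ h le_rfl
  · intro _
    simpa using hB0
  · intro s₀ s₁ i h0 hle hI ih hs
    -- Integrating factor: P grows at speed μ, so this product is nonincreasing along flows.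
    have hmono := hz.sub_le_of_flow (c := 0) hle hI
      (fun x => (V x - B) * Real.exp (2 * κ * P x))
      (fun s hs => by
        have hp : ContDiffAt ℝ 1 P (z s i) :=
          (contDiffAt_gainPotential A.Υ ℓ (zero_lt_one.trans_le (one_le_μ hz (hI s hs)))).comp
            (z s i) (by fun_prop : ContDiffAt ℝ 1 (fun x : State n => State.μ x) (z s i))
        have hv : ContDiffAt ℝ 1 V (z s i) := (contDiff_lyapunov _ _ _).contDiffAt
        fun_prop)
      (fun s hs' f hf hd => by
        have hsI := Set.Ioo_subset_Icc_self hs'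
        have hmem := hI s hsI
        have hμ := one_le_μ hz hmem
        obtain ⟨v, hv, hvle⟩ := exists_hasDerivAt_lyapunov_le hA hU ha hrich hb hc hlam hlam0 hκ0
          hκ hκd hD (y := fun s => z s i) (closedLoop_mem_flowSet hz hmem) hf hd (by
            rw [τ_eq hz hmem]
            exact hδ s ⟨h0.trans hsI.1, hsI.2.trans hs⟩)
        obtain ⟨p, hp, hpμ⟩ := exists_hasDerivAt_gainPotential hA.Υ_pos hℓ
          (zero_lt_one.trans_le hμ)
        have hfμ : f.2.2.2 = gainFlow A.Υ ℓ (State.μ (z s i)) := by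
          obtain ⟨_, _, _, _, _, h⟩ := hf
          exact h
        have hPd : HasDerivAt (fun s => P (z s i)) (State.μ (z s i)) s := by
          rw [← hpμ, ← hfμ]
          exact hp.comp s (State.hasDerivAt_μ hd)
        refine ⟨_, (hv.sub_const B).mul (hPd.const_mul (2 * κ)).exp, ?_⟩
        rw [hBeq] at hvle
        have he := Real.exp_pos (2 * κ * P (z s i))
        have : (v + (V (z s i) - B) * (2 * κ * State.μ (z s i))) *
            Real.exp (2 * κ * P (z s i)) ≤ 0 :=
          mul_nonpos_of_nonpos_of_nonneg (by linarith) he.le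
        linarith)
    have ih' := ih (hle.trans hs)
    have h1 : (V (z s₁ i) - B) * Real.exp (2 * κ * P (z s₁ i)) ≤
        (Real.exp (-(2 * κ) * (P (z s₀ i) - P (z 0 0))) * Real.exp (-(2 * κ) * i) *
          V (z 0 0)) * Real.exp (2 * κ * P (z s₀ i)) := by
      have := mul_le_mul_of_nonneg_right (sub_le_iff_le_add.2 ih')
        (Real.exp_pos (2 * κ * P (z s₀ i))).le
      linarith
    rw [← le_div_iff₀ (Real.exp_pos _)] at h1
    rw [← sub_le_iff_le_add]
    refine h1.trans (le_of_eq ?_)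
    have : Real.exp (-(2 * κ) * (P (z s₁ i) - P (z 0 0))) =
        Real.exp (-(2 * κ) * (P (z s₀ i) - P (z 0 0))) * Real.exp (2 * κ * P (z s₀ i)) /
          Real.exp (2 * κ * P (z s₁ i)) := by
      rw [← Real.exp_add, ← Real.exp_sub]
      ring_nf
    rw [this]
    ring
  · intro s i _ h1 h2 ih hs
    have hj := (hz.jump s i h1 h2).2
    have hPj : P (z s (i + 1)) = P (z s i) := by
      simp only [hP]; rw [hj.2.2.2]
    have hle1 : Real.exp (-(2 * κ)) ≤ 1 := Real.exp_le_one_iff.2 (by linarith)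
    rw [hPj, hV, lyapunov_jump hj, ← hV]
    have hexp : Real.exp (-(2 * κ) * ((i + 1 : ℕ) : ℝ)) =
        Real.exp (-(2 * κ)) * Real.exp (-(2 * κ) * i) := by
      rw [← Real.exp_add]; push_cast; ring_nf
    rw [hexp]
    have h3 := mul_le_mul_of_nonneg_left (ih hs) (Real.exp_pos (-(2 * κ))).le
    have h4 : Real.exp (-(2 * κ)) * B ≤ B := mul_le_of_le_one_left hB0 hle1
    linarith

/-! ### Error bound, gains and choice of constants. -/

theorem classK_const_mul {C : ℝ≥0} (hC : 0 < C) : ClassK fun s => C * s :=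
  ⟨by fun_prop, fun _ _ h => mul_lt_mul_of_pos_left h hC, mul_zero _⟩

theorem Unknowns.BoundedOn.abs_le {τ0 t : ℝ} (h : U.BoundedOn τ0 t) {s : ℝ}
    (hs : s ∈ Set.Icc 0 t) : |U.d (τ0 + s)| ≤ U.supDisturbance τ0 t := by
  have : ‖U.d (τ0 + s)‖₊ ≤ U.supDisturbance τ0 t := le_ciSup h ⟨s, hs⟩
  exact this

/-- The error bound, in terms of the norm of the lumped input. -/
theorem norm_error_le (hA : A.Standing) (hU : U.Compatible A) (hℓ : 1 ≤ ℓ) {a : ℝ}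
    (ha : 0 < a) (hrich : ∀ q ∈ A.Qs, RichWithLevel (A.Φ q) a)
    {b : ℝ} (hb : ∀ t : ℝ, 0 ≤ t → ‖A.φ t‖ ≤ b)
    {c κ lam : ℝ} (hc : c = A.kr * a + (A.varpi - 1)) (hc0 : 0 ≤ c)
    (hlam : lam = A.kr * a - c * (1 / A.τa)) (hlam0 : 0 < lam)
    (hκ0 : 0 < κ) (hκ : κ ≤ lam / 4) (hκd : κ * (1 / A.τd) ≤ lam / 4)
    (hz : (closedLoop A U ℓ).IsSolution dom z) {t : ℝ} {j : ℕ} (h : (t, j) ∈ dom)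
    (hbdd : U.BoundedOn (State.τ (z 0 0)) t) :
    ‖State.θ (z t j) - U.θstar‖ ≤
      Real.exp (c * A.T0 + κ * A.N0) *
        Real.exp (-κ * dilation A.Υ ℓ (State.μ (z 0 0)) t) * Real.exp (-κ * j) *
        ‖State.θ (z 0 0) - U.θstar‖ +
      Real.exp (c * A.T0 + κ * A.N0) / √(2 * κ * lam) *
        (A.kt * b * U.supDisturbance (State.τ (z 0 0)) t +
          A.kr * (A.recordedSize * ‖U.recordedNoise A‖ + U.corruptionLevel A)) := by
  have hmain := lyapunov_le hA hU hℓ ha hrich hb hc hlam hlam0 hκ0 hκ hκd rfl hz h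
    (fun s hs => hbdd.abs_le hs)
  have hb0 : 0 ≤ b := (norm_nonneg _).trans (hb 0 le_rfl)
  have hD0 : 0 ≤ A.kt * b * U.supDisturbance (State.τ (z 0 0)) t +
      A.kr * (A.recordedSize * ‖U.recordedNoise A‖ + U.corruptionLevel A) := by
    have := hA.kt_pos
    have := hA.kr_pos
    have := A.recordedSize_nonneg
    positivity
  set D := A.kt * b * U.supDisturbance (State.τ (z 0 0)) t +
      A.kr * (A.recordedSize * ‖U.recordedNoise A‖ + U.corruptionLevel A)
  have hdouble : ∀ u : ℝ, Real.exp (2 * u) = Real.exp u ^ 2 := fun u => by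
    rw [← Real.exp_nat_mul]; norm_num
  have hlow : ‖State.θ (z t j) - U.θstar‖ ^ 2 ≤ lyapunov U.θstar c κ (z t j) := by
    obtain ⟨⟨-, hρd, hρa⟩, -, -⟩ := closedLoop_mem_flowSet hz h
    refine le_mul_of_one_le_left (by positivity) (Real.one_le_exp ?_)
    have h1 := hρd.1
    have h2 := hρa.1
    positivity
  have hup : lyapunov U.θstar c κ (z 0 0) ≤
      Real.exp (c * A.T0 + κ * A.N0) ^ 2 * ‖State.θ (z 0 0) - U.θstar‖ ^ 2 := by
    obtain ⟨⟨-, hρd, hρa⟩, -, -⟩ := closedLoop_mem_flowSet hz hz.start_mem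
    rw [← hdouble]
    have h1 := hρd.2
    have h2 := hρa.2
    unfold lyapunov
    gcongr
  set K := Real.exp (c * A.T0 + κ * A.N0)
  have hK : 0 < K := Real.exp_pos _
  rw [hdouble] at hmain
  have e1 : Real.exp (-(2 * κ) * dilation A.Υ ℓ (State.μ (z 0 0)) t) =
      Real.exp (-κ * dilation A.Υ ℓ (State.μ (z 0 0)) t) ^ 2 := by
    rw [← hdouble]; ring_nf
  have e2 : Real.exp (-(2 * κ) * j) = Real.exp (-κ * j) ^ 2 := by
    rw [← hdouble]; ring_nf
  rw [e1, e2] at hmain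
  set s := Real.exp (-κ * dilation A.Υ ℓ (State.μ (z 0 0)) t)
  set r := Real.exp (-κ * j)
  have hs : 0 < s := Real.exp_pos _
  have hr : 0 < r := Real.exp_pos _
  have e3 : K ^ 2 * (D ^ 2 / lam) / (2 * κ) = (K / √(2 * κ * lam) * D) ^ 2 := by
    rw [mul_pow, div_pow, Real.sq_sqrt (by positivity)]
    field_simp
  rw [e3] at hmain
  set g := K / √(2 * κ * lam) * D
  have hg : 0 ≤ g := by positivity
  set X := ‖State.θ (z 0 0) - U.θstar‖
  have hX : 0 ≤ X := norm_nonneg _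
  have hsq : ‖State.θ (z t j) - U.θstar‖ ^ 2 ≤ (K * s * r * X + g) ^ 2 := by
    calc ‖State.θ (z t j) - U.θstar‖ ^ 2
        ≤ s ^ 2 * r ^ 2 * lyapunov U.θstar c κ (z 0 0) + g ^ 2 := hlow.trans hmain
      _ ≤ s ^ 2 * r ^ 2 * (K ^ 2 * X ^ 2) + g ^ 2 := by gcongr
      -- The nonnegative cross term completes the square, so that the root can be taken.
      _ ≤ s ^ 2 * r ^ 2 * (K ^ 2 * X ^ 2) + g ^ 2 + 2 * (K * s * r * X) * g :=
        le_add_of_nonneg_right (by positivity)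
      _ = (K * s * r * X + g) ^ 2 := by ring
  exact (pow_le_pow_iff_left₀ (norm_nonneg _) (by positivity) two_ne_zero).1 hsq

/-- The input part of the error bound is dominated by class-`𝒦` gains. -/
theorem exists_gains_bound (hA : A.Standing) {b g : ℝ} (hb : 0 ≤ b) (hg : 0 ≤ g) :
    ∃ γ₁ γ₂ γ₃ : ℝ≥0 → ℝ≥0, ClassK γ₁ ∧ ClassK γ₂ ∧ ClassK γ₃ ∧
      ∀ (U : Unknowns n) (τ0 t : ℝ),
        g * (A.kt * b * U.supDisturbance τ0 t +
          A.kr * (A.recordedSize * ‖U.recordedNoise A‖ + U.corruptionLevel A)) ≤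
        gains A U γ₁ γ₂ γ₃ τ0 t := by
  have hkt := hA.kt_pos
  have hkr := hA.kr_pos
  have hR := A.recordedSize_nonneg
  obtain ⟨c₁, h₁⟩ : ∃ c : ℝ≥0, (c : ℝ) = g * (A.kt * b) := ⟨⟨_, by positivity⟩, rfl⟩
  obtain ⟨c₂, h₂⟩ : ∃ c : ℝ≥0, (c : ℝ) = g * (A.kr * A.recordedSize) :=
    ⟨⟨_, by positivity⟩, rfl⟩
  obtain ⟨c₃, h₃⟩ : ∃ c : ℝ≥0, (c : ℝ) = g * A.kr := ⟨⟨_, by positivity⟩, rfl⟩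
  -- A coefficient may vanish, for instance when nothing is recorded; adding 1 keeps each gain
  -- strictly increasing.
  refine ⟨_, _, _, classK_const_mul (C := c₁ + 1) (by positivity),
    classK_const_mul (C := c₂ + 1) (by positivity),
    classK_const_mul (C := c₃ + 1) (by positivity), fun U τ0 t => ?_⟩
  simp only [gains, NNReal.coe_mul, NNReal.coe_add, NNReal.coe_one, coe_nnnorm, h₁, h₂, h₃]
  have e₁ := NNReal.coe_nonneg (U.supDisturbance τ0 t)
  have e₂ := norm_nonneg (U.recordedNoise A)
  have e₃ := NNReal.coe_nonneg (U.corruptionLevel A)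
  linarith

/-- All constants come from the algorithm and a regressor bound. They are fixed before the unknowns,
ℓ and the solution, which gives the uniformity. -/
theorem exists_error_bound (hA : A.Standing) {a : ℝ} (ha : 0 < a)
    (hrich : ∀ q ∈ A.Qs, RichWithLevel (A.Φ q) a) (hτd : 0 < A.τd)
    (hτa : 1 + A.varpi / (A.kr * a) < A.τa) :
    ∃ (κ₁ κ₂ : ℝ) (γ₁ γ₂ γ₃ : ℝ≥0 → ℝ≥0), 0 < κ₁ ∧ 0 < κ₂ ∧
      ClassK γ₁ ∧ ClassK γ₂ ∧ ClassK γ₃ ∧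
      ∀ (U : Unknowns n), U.Compatible A → ∀ (ℓ : ℝ≥0∞), 1 ≤ ℓ →
        ∀ (dom : Set (ℝ × ℕ)) (z : ℝ → ℕ → State n), (closedLoop A U ℓ).IsSolution dom z →
        ∀ (t : ℝ) (j : ℕ), (t, j) ∈ dom → U.BoundedOn (State.τ (z 0 0)) t →
          ‖State.θ (z t j) - U.θstar‖ ≤
            κ₁ * Real.exp (-κ₂ * dilation A.Υ ℓ (State.μ (z 0 0)) t) *
                Real.exp (-κ₂ * (j : ℝ)) * ‖State.θ (z 0 0) - U.θstar‖
              + gains A U γ₁ γ₂ γ₃ (State.τ (z 0 0)) t := by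
  obtain ⟨b, hb⟩ := hA.regressor_bounded
  have hb0 : 0 ≤ b := (norm_nonneg _).trans (hb 0 le_rfl)
  have hkr := hA.kr_pos
  have hvar : 0 ≤ A.varpi - 1 := by
    rw [Algorithm.varpi, add_sub_cancel_left]; positivity
  obtain ⟨c, hc⟩ : ∃ c, c = A.kr * a + (A.varpi - 1) := ⟨_, rfl⟩
  have hka : 0 < A.kr * a := by positivity
  have hc0 : 0 ≤ c := by linarith
  have hτa0 : 0 < A.τa := by
    have : 0 ≤ A.varpi / (A.kr * a) := div_nonneg (by linarith) hka.le
    linarith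
  obtain ⟨lam, hlam⟩ : ∃ lam, lam = A.kr * a - c * (1 / A.τa) := ⟨_, rfl⟩
  have hlam0 : 0 < lam := by
    -- The dwell condition times k_r a gives k_r a τ_a > k_r a + ϖ, which exceeds c by 1.
    have h1 : c < A.kr * a * A.τa := by
      have h2 := mul_lt_mul_of_pos_left hτa hka
      have h3 : A.kr * a * (1 + A.varpi / (A.kr * a)) = A.kr * a + A.varpi := by field_simp
      linarith
    rw [hlam, mul_one_div, sub_pos, div_lt_iff₀ hτa0]
    exact h1
  obtain ⟨κ, hκ0, hκ, hκd⟩ : ∃ κ : ℝ, 0 < κ ∧ κ ≤ lam / 4 ∧ κ * (1 / A.τd) ≤ lam / 4 := by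
    refine ⟨min (lam / 4) (lam / 4 * A.τd), by positivity, min_le_left _ _, ?_⟩
    rw [mul_one_div, div_le_iff₀ hτd]
    exact min_le_right _ _
  obtain ⟨γ₁, γ₂, γ₃, h₁, h₂, h₃, hγ⟩ := exists_gains_bound hA hb0
    (g := Real.exp (c * A.T0 + κ * A.N0) / √(2 * κ * lam)) (by positivity)
  refine ⟨Real.exp (c * A.T0 + κ * A.N0), κ, γ₁, γ₂, γ₃, Real.exp_pos _, hκ0, h₁, h₂, h₃, ?_⟩
  intro U hU ℓ hℓ dom z hz t j h hbdd
  exact (norm_error_le hA hU hℓ ha hrich hb hc hc0 hlam hlam0 hκ0 hκ hκd hz h hbdd).trans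
    (by gcongr; exact hγ U _ t)

open Filter Topology in
/-- For `ℓ > 1` every exponential transient becomes small before the end time. -/
theorem exists_time_exp_dilation_le {Υ : ℝ} (hΥ : 0 < Υ) {ℓ : ℝ≥0∞} (hℓ : 1 < ℓ) {c : ℝ}
    (hc : 0 < c) {κ : ℝ} (hκ : 0 < κ) (M : ℝ) {ε : ℝ} (hε : 0 < ε) :
    ∃ tε : ℝ, 0 ≤ tε ∧ (tε : EReal) < endTime Υ ℓ c ∧
      ∀ t : ℝ, tε ≤ t → (t : EReal) < endTime Υ ℓ c →
        M * Real.exp (-κ * dilation Υ ℓ c t) ≤ ε := by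
  obtain ⟨T, hT, hend, hlim⟩ := exists_tendsto_dilation hΥ hℓ hc
  have h1 : Tendsto (fun t => M * Real.exp (-κ * dilation Υ ℓ c t)) (𝓝[<] T) (𝓝 0) := by
    have := (Real.tendsto_exp_atBot.comp
      (hlim.const_mul_atTop_of_neg (neg_lt_zero.2 hκ))).const_mul M
    simpa using this
  obtain ⟨l, hl, hsub⟩ := (mem_nhdsLT_iff_exists_Ioo_subset' hT).1
    (h1.eventually (eventually_le_nhds hε))
  rw [Set.mem_Iio] at hl
  -- The midpoint lies strictly inside (l, T), as the open interval requires; the maximum only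
  -- ensures a nonnegative time.
  refine ⟨max 0 ((l + T) / 2), le_max_left _ _, ?_, fun t ht htT => ?_⟩
  · rw [hend, EReal.coe_lt_coe_iff]
    exact max_lt hT (by linarith)
  · rw [hend, EReal.coe_lt_coe_iff] at htT
    have := (le_max_right 0 ((l + T) / 2)).trans ht
    exact hsub ⟨by linarith, htT⟩

end CL

/-! ### The theorem. -/

theorem theorem1 {n : ℕ} (A : CL.Algorithm n) (hA : A.Standing)
    (α : ℕ → ℝ) (hα : ∀ q ∈ A.Qs, 0 < α q ∧ CL.RichWithLevel (A.Φ q) (α q))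
    (hQs : A.Qs.Nonempty)
    (hτd : 0 < A.τd)
    (hτa : 1 + A.varpi / (A.kr * A.Qs.inf' hQs α) < A.τa) :
    ∃ (κ₁ κ₂ : ℝ) (γ₁ γ₂ γ₃ : ℝ≥0 → ℝ≥0), 0 < κ₁ ∧ 0 < κ₂ ∧
      CL.ClassK γ₁ ∧ CL.ClassK γ₂ ∧ CL.ClassK γ₃ ∧
      -- the error bound, for every solution and every `ℓ ∈ [1, ∞]`
      (∀ (U : CL.Unknowns n), U.Compatible A → ∀ (ℓ : ℝ≥0∞), 1 ≤ ℓ →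
        ∀ (dom : Set (ℝ × ℕ)) (z : ℝ → ℕ → CL.State n),
        (CL.closedLoop A U ℓ).IsSolution dom z →
        ∀ (t : ℝ) (j : ℕ), (t, j) ∈ dom →
          (t : EReal) < CL.endTime A.Υ ℓ (CL.State.μ (z 0 0)) ∧
          (U.BoundedOn (CL.State.τ (z 0 0)) t →
            ‖CL.State.θ (z t j) - U.θstar‖ ≤
              κ₁ * Real.exp (-κ₂ * CL.dilation A.Υ ℓ (CL.State.μ (z 0 0)) t) *
                  Real.exp (-κ₂ * (j : ℝ)) * ‖CL.State.θ (z 0 0) - U.θstar‖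
                + CL.gains A U γ₁ γ₂ γ₃ (CL.State.τ (z 0 0)) t)) ∧
      -- `ℓ = 1`: the transient decays faster than any exponential in `t`
      (∀ r : ℝ, 0 < r → ∃ M : ℝ, 0 < M ∧
        ∀ (U : CL.Unknowns n), U.Compatible A →
        ∀ (dom : Set (ℝ × ℕ)) (z : ℝ → ℕ → CL.State n),
        (CL.closedLoop A U 1).IsSolution dom z →
        ∀ (t : ℝ) (j : ℕ), (t, j) ∈ dom → U.BoundedOn (CL.State.τ (z 0 0)) t →
          ‖CL.State.θ (z t j) - U.θstar‖ ≤
            M * Real.exp (-r * t) * Real.exp (-κ₂ * (j : ℝ)) * ‖CL.State.θ (z 0 0) - U.θstar‖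
              + CL.gains A U γ₁ γ₂ γ₃ (CL.State.τ (z 0 0)) t) ∧
      -- `ℓ > 1`: the ultimate bound is approached as `t` tends to the prescribed time
      (∀ (ℓ : ℝ≥0∞), 1 < ℓ → ∀ (μ₀ R ε : ℝ), 1 ≤ μ₀ → 0 < R → 0 < ε →
        ∃ tε : ℝ, 0 ≤ tε ∧ (tε : EReal) < CL.endTime A.Υ ℓ μ₀ ∧
        ∀ (U : CL.Unknowns n), U.Compatible A →
        ∀ (dom : Set (ℝ × ℕ)) (z : ℝ → ℕ → CL.State n),
        (CL.closedLoop A U ℓ).IsSolution dom z →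
        CL.State.μ (z 0 0) = μ₀ → ‖CL.State.θ (z 0 0) - U.θstar‖ ≤ R →
        ∀ (t : ℝ) (j : ℕ), (t, j) ∈ dom → tε ≤ t → U.BoundedOn (CL.State.τ (z 0 0)) t →
          ‖CL.State.θ (z t j) - U.θstar‖ ≤
            ε + CL.gains A U γ₁ γ₂ γ₃ (CL.State.τ (z 0 0)) t) := by
  have ha : 0 < A.Qs.inf' hQs α := (Finset.lt_inf'_iff hQs).2 fun q hq => (hα q hq).1
  have hrich : ∀ q ∈ A.Qs, CL.RichWithLevel (A.Φ q) (A.Qs.inf' hQs α) := by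
    intro q hq
    have h1 : 0 ≤ α q - A.Qs.inf' hQs α := sub_nonneg.2 (Finset.inf'_le α hq)
    -- Lowering the richness level to the minimum adds a nonnegative multiple of the identity.
    have h2 := (hα q hq).2.add (Matrix.PosSemidef.one.smul h1)
    have h3 : A.Φ q - α q • (1 : Matrix (Fin n) (Fin n) ℝ) +
        (α q - A.Qs.inf' hQs α) • (1 : Matrix (Fin n) (Fin n) ℝ) =
        A.Φ q - A.Qs.inf' hQs α • (1 : Matrix (Fin n) (Fin n) ℝ) := by
      rw [sub_smul]; abel
    rwa [h3] at h2
  have hΥ := hA.Υ_pos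
  obtain ⟨κ₁, κ₂, γ₁, γ₂, γ₃, hκ₁, hκ₂, h₁, h₂, h₃, hbound⟩ :=
    CL.exists_error_bound hA ha hrich hτd hτa
  refine ⟨κ₁, κ₂, γ₁, γ₂, γ₃, hκ₁, hκ₂, h₁, h₂, h₃, ?_, ?_, ?_⟩
  · intro U hU ℓ hℓ dom z hz t j h
    exact ⟨(CL.lt_endTime_and_dilation_eq_of_solution hΥ hℓ hz h).1,
      hbound U hU ℓ hℓ dom z hz t j h⟩
  · intro r _
    obtain ⟨C, hC⟩ := CL.exists_mul_le_dilation_one hΥ hκ₂ r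
    -- C is the additive loss in r t - C ≤ κ₂ 𝒟(t), uniform over all initial gains.
    refine ⟨κ₁ * Real.exp C, by positivity, ?_⟩
    intro U hU dom z hz t j h hbdd
    refine (hbound U hU 1 le_rfl dom z hz t j h hbdd).trans ?_
    have h4 := hC (CL.State.μ (z 0 0)) t (CL.one_le_μ hz hz.start_mem) (hz.time_domain.1 _ h)
    have h5 : κ₁ * Real.exp (-κ₂ * CL.dilation A.Υ 1 (CL.State.μ (z 0 0)) t) ≤
        κ₁ * Real.exp C * Real.exp (-r * t) := by
      rw [mul_assoc, ← Real.exp_add]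
      gcongr
      linarith
    gcongr
  · intro ℓ hℓ μ₀ R ε hμ₀ _ hε
    obtain ⟨tε, h0, hlt, hsmall⟩ := CL.exists_time_exp_dilation_le hΥ hℓ
      (zero_lt_one.trans_le hμ₀) hκ₂ (κ₁ * R) hε
    refine ⟨tε, h0, hlt, ?_⟩
    intro U hU dom z hz hμ hR t j h ht hbdd
    refine (hbound U hU ℓ hℓ.le dom z hz t j h hbdd).trans ?_
    have hend := (CL.lt_endTime_and_dilation_eq_of_solution hΥ hℓ.le hz h).1
    rw [hμ] at hend ⊢
    have hexp : Real.exp (-κ₂ * (j : ℝ)) ≤ 1 :=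
      Real.exp_le_one_iff.2 (mul_nonpos_of_nonpos_of_nonneg (by linarith) (Nat.cast_nonneg j))
    gcongr
    calc κ₁ * Real.exp (-κ₂ * CL.dilation A.Υ ℓ μ₀ t) * Real.exp (-κ₂ * (j : ℝ)) *
          ‖CL.State.θ (z 0 0) - U.θstar‖
        ≤ κ₁ * Real.exp (-κ₂ * CL.dilation A.Υ ℓ μ₀ t) * 1 * R := by gcongr
      _ = κ₁ * R * Real.exp (-κ₂ * CL.dilation A.Υ ℓ μ₀ t) := by ring
      _ ≤ ε := hsmall t ht hend
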